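/- Let $\lambda>\mu$ be infinite cardinals with $\mu$ regular ($\mathrm{cf}(\mu)=\mu$) and $\mathrm{cf}(\lambda)\ge\mu$. Cardinals are identified with initial ordinals. Let $S^\lambda_\mu=\{\alpha<\lambda:\mathrm{cf}(\alpha)=\mu\}$. Let $\mathcal M=\{M^\varphi:\varphi<\kappa\}$ (enumerated without repetition by an ordinal $\kappa$) be a MAD family on $\mu$: each $M^\varphi\subseteq\mu$ has cardinality $\mu$, $|M^\varphi\cap M^\psi|<\mu$ for $\varphi\ne\psi$, and for each $A\subseteq\mu$ with $|A|=\mu$ there is $\varphi<\kappa$ with $|A\cap M^\varphi|=\mu$. Let $\underline C=\langle C_\alpha:\alpha\in S^\lambda_\mu\rangle$ be an $S^\lambda_\mu$-club sequence: each $C_\alpha\subseteq\alpha$ is closed and unbounded in $\alpha$ and has order type $\mu$. Let $C_\alpha=\{a_\alpha^\xi:\xi<\mu\}$ be the increasing enumeration, and put $I_\alpha^\xi=[a_\alpha^\xi,a_\alpha^{\xi+1}]$ if $\xi<\mu$ is a limit ordinal and $I_\alpha^\xi=(a_\alpha^\xi,a_\alpha^{\xi+1}]$ if $\xi<\mu$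 is $0$ or a successor. The space $X=X[\lambda,\mu,\mathcal M,\underline C]$ has underlying set $\bigcup_{\alpha<\lambda}X_\alpha\subseteq\lambda\times\kappa$, where $X_\alpha=\{\alpha\}\times\kappa$ if $\alpha\in S^\lambda_\mu$ and $X_\alpha=\{(\alpha,0)\}$ otherwise. Its topology is given by the following neighborhood bases: - at $(\alpha,\varphi)$ with $\mathrm{cf}(\alpha)=\mu$: the sets $\{(\alpha,\varphi)\}\cup\bigcup\{X_\gamma:\gamma\in I_\alpha^\xi\text{ for some }\xi\in M^\varphi\setminus\eta\}$ for $\eta<\mu$; - at $(\alpha,0)$ with $\alpha$ equal to $0$, a successor, or a limit with $\mathrm{cf}(\alpha)<\mu$: the set $\{(\alpha,0)\}$; - at $(\alpha,0)$ with $\mathrm{cf}(\alpha)>\mu$: the sets $\bigcup\{X_\gamma:\beta<\gamma\le\alpha\}$ for $\beta<\alpha$. A set $F\subseteq X$ is unbounded if $\{\alpha<\lambda:F\cap X_\alpha\neq\emptyset\}$ is unbounded in $\lambda$, and $X$ is high if $|\{\alpha<\lambda:|F\cap X_\alpha|=|F|\}|\ge\mu$ for every closed unbounded $F\subseteq X$.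 If $X$ is high, then: 1. $X$ is $0$-dimensional, that is, it has a base of clopen sets; 2. $X$ is Hausdorff; 3. $X$ is scattered, that is, every nonempty subspace has an isolated point; 4. $X$ is aD: for every closed $F\subseteq X$ and every open cover $\mathcal U$ of $X$ there are a closed discrete $A\subseteq F$ and a map $\phi:A\to\mathcal U$ with $a\in\phi(a)$ for all $a\in A$ and $F\subseteq\bigcup_{a\in A}\phi(a)$; 5. $X$ is not linearly D, where linearly D means: for every assignment of an open set $U(x)\ni x$ to each $x\in X$ such that $\{U(x):x\in X\}$ is linearly ordered by inclusion, there is a closed discrete $D\subseteq X$ with $X=\bigcup_{d\in D}U(d)$. -/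

import Mathlib

universe u v

/-! ### Topological notions -/

/-- Zero-dimensional: the clopen sets form a base. -/
def ZeroDim (X : Type v) [TopologicalSpace X] : Prop :=
  TopologicalSpace.IsTopologicalBasis {s : Set X | IsClopen s}

/-- Scattered: every nonempty subspace has an isolated point. -/
def ScatteredSpace (X : Type v) [TopologicalSpace X] : Prop :=
  ∀ S : Set X, S.Nonempty → ∃ x ∈ S, ∃ U : Set X, IsOpen U ∧ U ∩ S = {x}

/-- A closed set which is discrete in the subspace topology. -/
def ClosedDiscrete {X : Type v} [TopologicalSpace X] (A : Set X) : Prop :=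
  IsClosed A ∧ IsDiscrete A

/-- Property aD. -/
def IsADSpace (X : Type v) [TopologicalSpace X] : Prop :=
  ∀ F : Set X, IsClosed F → ∀ 𝒰 : Set (Set X), (∀ U ∈ 𝒰, IsOpen U) → ⋃₀ 𝒰 = Set.univ →
    ∃ A : Set X, A ⊆ F ∧ ClosedDiscrete A ∧
      ∃ φ : A → Set X, (∀ a, φ a ∈ 𝒰 ∧ (a : X) ∈ φ a) ∧ F ⊆ ⋃ a, φ a

/-- Linearly D: every open neighborhood assignment whose range is linearly ordered by inclusion
has a closed discrete kernel. -/
def IsLinearlyD (X : Type v) [TopologicalSpace X] : Prop :=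
  ∀ U : X → Set X, (∀ x, IsOpen (U x) ∧ x ∈ U x) → (∀ x y, U x ⊆ U y ∨ U y ⊆ U x) →
    ∃ D : Set X, ClosedDiscrete D ∧ ⋃ d ∈ D, U d = Set.univ

/-! ### Combinatorial notions

A cardinal `μ` is identified with its initial ordinal `μ.ord`, and an ordinal `δ` with the set
`Set.Iio δ` of smaller ordinals. -/

/-- The subsets of `μ` of cardinality `μ`. -/
def fullSubsets (μ : Cardinal.{u}) : Set (Set Ordinal.{u}) :=
  {A | A ⊆ Set.Iio μ.ord ∧ Cardinal.mk A = Cardinal.lift.{u + 1} μ}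

/-- Maximal almost disjoint families on `μ`. -/
structure IsMADFamily (μ : Cardinal.{u}) (𝓜 : Set (Set Ordinal.{u})) : Prop where
  subset : 𝓜 ⊆ fullSubsets μ
  almostDisjoint : ∀ M ∈ 𝓜, ∀ N ∈ 𝓜, M ≠ N →
    Cardinal.mk (M ∩ N : Set Ordinal.{u}) < Cardinal.lift.{u + 1} μ
  maximal : ∀ A ∈ fullSubsets μ, ∃ M ∈ 𝓜,
    Cardinal.mk (A ∩ M : Set Ordinal.{u}) = Cardinal.lift.{u + 1} μ

/-- `S^lam_μ`: the ordinals below `lam` of cofinality `μ`. -/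
def cofSet (lam μ : Cardinal.{u}) : Set Ordinal.{u} :=
  {δ | δ < lam.ord ∧ δ.cof = μ}

/-- `C` is an `S^lam_μ`-club sequence: for `δ ∈ S^lam_μ`, `C δ ⊆ δ` is a club in `δ` of order
type `μ`. The values of `C` outside `S^lam_μ` are irrelevant. -/
def IsClubSeq (lam μ : Cardinal.{u}) (C : Ordinal.{u} → Set Ordinal.{u}) : Prop :=
  ∀ δ ∈ cofSet lam μ, C δ ⊆ Set.Iio δ ∧ IsClub {x : Set.Iio δ | (x : Ordinal.{u}) ∈ C δ} ∧
    Ordinal.type (fun x y : C δ => x < y) = Ordinal.lift.{u + 1} μ.ord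

/-- The increasing enumeration of a set of ordinals: `incEnum S ξ` is the least element of `S`
above all earlier values (it is used only for `ξ` below the order type of `S`). -/
noncomputable def incEnum (S : Set Ordinal.{u}) (ξ : Ordinal.{u}) : Ordinal.{u} :=
  sInf {a | a ∈ S ∧ ∀ ζ, ζ < ξ → incEnum S ζ < a}
termination_by ξ

open scoped Classical in
/-- The interval `I^ξ` determined by a club with increasing enumeration `a`:
`[a ξ, a (ξ + 1)]` if `ξ` is a limit ordinal and `(a ξ, a (ξ + 1)]` if `ξ` is zero or a
successor. -/
noncomputable def clubInterval (S : Set Ordinal.{u}) (ξ : Ordinal.{u}) : Set Ordinal.{u} :=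
  if Order.IsSuccLimit ξ then Set.Icc (incEnum S ξ) (incEnum S (ξ + 1))
  else Set.Ioc (incEnum S ξ) (incEnum S (ξ + 1))

/-! ### The space -/

/-- The space `X[lam, μ, 𝓜, C]`, where `𝓜 = {M φ : φ < κ}`: the pairs `(α, φ)` in `lam × κ` such
that `φ = 0` unless `α` has cofinality `μ`. The topology below depends on `M` and `C`. -/
@[nolint unusedArguments]
def ClubSpace (lam μ : Cardinal.{u}) (κ : Ordinal.{u}) (_M : Ordinal.{u} → Set Ordinal.{u})
    (_C : Ordinal.{u} → Set Ordinal.{u}) : Type (u + 1) :=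
  {p : Ordinal.{u} × Ordinal.{u} // p.1 < lam.ord ∧ p.2 < κ ∧ (p.1.cof ≠ μ → p.2 = 0)}

namespace ClubSpace

variable {lam μ : Cardinal.{u}} {κ : Ordinal.{u}} {M C : Ordinal.{u} → Set Ordinal.{u}}

/-- The first coordinate of a point; the fibre over `α` is `X_α`. -/
def fst (x : ClubSpace lam μ κ M C) : Ordinal.{u} := x.1.1

/-- The second coordinate of a point. -/
def snd (x : ClubSpace lam μ κ M C) : Ordinal.{u} := x.1.2

/-- The set `U((α, φ), η)` at a point `x = (α, φ)` with `α` of cofinality `μ`. -/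
def nhdMid (x : ClubSpace lam μ κ M C) (η : Ordinal.{u}) : Set (ClubSpace lam μ κ M C) :=
  {x} ∪ {y | ∃ ξ ∈ M x.snd, η ≤ ξ ∧ y.fst ∈ clubInterval (C x.fst) ξ}

/-- The set `U(α, β)` at a point `x = (α, 0)` with `α` of cofinality greater than `μ`. -/
def nhdHigh (x : ClubSpace lam μ κ M C) (β : Ordinal.{u}) : Set (ClubSpace lam μ κ M C) :=
  {y | β < y.fst ∧ y.fst ≤ x.fst}

/-- The neighborhood base prescribed at a point `x = (α, φ)`: the sets `U((α, φ), η)`, `η < μ`, if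
`α` has cofinality `μ`; the sets `U(α, β)`, `β < α`, if `α` has larger cofinality; and `{x}`
otherwise, that is, if `α` is zero, a successor, or a limit of cofinality less than `μ`. -/
def nhdBase (x : ClubSpace lam μ κ M C) : Set (Set (ClubSpace lam μ κ M C)) :=
  {B | (x.fst.cof = μ ∧ ∃ η < μ.ord, B = nhdMid x η) ∨
    (μ < x.fst.cof ∧ ∃ β < x.fst, B = nhdHigh x β) ∨
    (x.fst.cof < μ ∧ B = {x})}

/-- The topology generated by the prescribed neighborhood bases: a set is open when it belongs, for
each of its points `x`, to the filter generated by the base at `x`. -/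
instance : TopologicalSpace (ClubSpace lam μ κ M C) :=
  TopologicalSpace.mkOfNhds fun x => ⨅ B ∈ nhdBase x, Filter.principal B

/-- `F` is unbounded: the set of first coordinates of points of `F` is unbounded in `lam`. -/
def Unbounded (F : Set (ClubSpace lam μ κ M C)) : Prop :=
  ∀ β < lam.ord, ∃ x ∈ F, β < x.fst

/-- `F` is high enough: `|{α < lam : |F ∩ X_α| = |F|}| ≥ μ`. -/
def HighEnough (F : Set (ClubSpace lam μ κ M C)) : Prop :=
  Cardinal.lift.{u + 1} μ ≤ Cardinal.mk {α : Ordinal.{u} | α < lam.ord ∧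
    Cardinal.mk {x : ClubSpace lam μ κ M C | x ∈ F ∧ x.fst = α} = Cardinal.mk F}

end ClubSpace

/-- `X[lam, μ, 𝓜, C]` is high: each of its closed unbounded subsets is high enough. -/
def IsHighClubSpace (lam μ : Cardinal.{u}) (κ : Ordinal.{u}) (M C : Ordinal.{u} → Set Ordinal.{u}) :
    Prop :=
  ∀ F : Set (ClubSpace lam μ κ M C), IsClosed F → ClubSpace.Unbounded F → ClubSpace.HighEnough F

open Cardinal Ordinal Set

/-! Fewer than `μ` basic neighbourhoods of a point always contain a common one, so unions of fewer
than `μ` closed sets are closed. Together with the linear order of the intervals and the almost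
disjointness of the `M φ`, this makes the prescribed base clopen. Every point has a neighbourhood
whose other points have smaller first coordinate, whence scatteredness.

The rest hinges on accumulation (`exists_frequently_of_le_mk`). If `cf(lam) > μ`, any `μ` ordinals
below `lam` accumulate at some `α` of cofinality `μ`, and maximality of the MAD family gives a `φ`
such that every neighbourhood of `(α, φ)` contains whole fibres over some of them. Highness forces
`cf(lam) > μ` (`lt_cof_of_high`). A closed discrete set therefore meets fewer than `μ` fibres and is
bounded, so the assignment of initial segments refutes linear D.

For aD, bounded closed sets are handled by induction on the bound (`hasKernel_of_bounded`). In an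
unbounded closed set, highness supplies a fibre containing as many of its points as the whole set
has. These points are closed discrete and numerous enough to carry all needed cover members that
include the fibre. Remove what these members cover and repeat: before stage `μ` the remainder is
bounded, since otherwise one member of the cover would include two chosen fibres, and the later one
would already have been removed. -/

/-! ### Cofinality and subsets of a regular cardinal -/

theorem Ordinal.exists_lt_of_mk_lt_cof {s : Set Ordinal.{u}} {a : Ordinal.{u}}
    (ha : #s < Cardinal.lift.{u + 1} a.cof) (hs : ∀ i ∈ s, i < a) : ∃ b < a, ∀ i ∈ s, i < b := by
  rw [lift_cof] at ha
  refine ⟨_, sSup_add_one_lt_of_lt_cof ha hs, fun i hi => ?_⟩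
  refine (lt_add_one i).trans_le (le_csSup ⟨a, ?_⟩ (mem_image_of_mem _ hi))
  rintro _ ⟨j, hj, rfl⟩
  exact Order.add_one_le_of_lt (hs j hj)

theorem Cardinal.IsRegular.exists_lt_of_mk_lt {μ : Cardinal.{u}} (hμ : μ.IsRegular)
    {s : Set Ordinal.{u}} (ha : #s < Cardinal.lift.{u + 1} μ) (hs : ∀ i ∈ s, i < μ.ord) :
    ∃ b < μ.ord, ∀ i ∈ s, i < b :=
  exists_lt_of_mk_lt_cof (by rwa [hμ.cof_ord]) hs

theorem Cardinal.mk_Iio_lt_lift {μ : Cardinal.{u}} {ξ : Ordinal.{u}} (h : ξ < μ.ord) :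
    #(Iio ξ) < Cardinal.lift.{u + 1} μ := by
  rw [Cardinal.mk_Iio_ordinal, Cardinal.lift_lt]
  exact lt_ord.1 h

/-- A cofinal set of least possible order type has initial segments smaller than the cofinality. -/
theorem Ordinal.exists_unbounded_of_cof (a : Ordinal.{u}) :
    ∃ s ⊆ Iio a, #s = Cardinal.lift.{u + 1} a.cof ∧ (∀ b < a, ∃ i ∈ s, b ≤ i) ∧
      ∀ c ∈ s, #{x | x ∈ s ∧ x < c} < Cardinal.lift.{u + 1} a.cof := by
  obtain ⟨s, hs, hs'⟩ := exists_ord_cof_eq (Iio a)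
  have hc : (Order.cof (Iio a)) = Cardinal.lift.{u + 1} a.cof := by rw [cof_Iio, lift_cof]
  rw [hc] at hs'
  refine ⟨Subtype.val '' s, ?_, ?_, fun b hb => ?_, ?_⟩
  · rintro _ ⟨x, -, rfl⟩
    exact x.2
  · rw [mk_image_eq Subtype.val_injective, ← card_ord (Cardinal.lift.{u + 1} a.cof), ← hs',
      card_type]
  · obtain ⟨y, hy, hby⟩ := hs ⟨b, hb⟩
    exact ⟨y, mem_image_of_mem _ hy, hby⟩
  · rintro _ ⟨c, hc, rfl⟩
    have h := typein_lt_type (fun x y : s => x < y) ⟨c, hc⟩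
    rw [hs', lt_ord, card_typein] at h
    refine lt_of_le_of_lt ?_ h
    have himg : {x | x ∈ Subtype.val '' s ∧ x < (c : Ordinal.{u})} ⊆
        (fun x : s => ((x : Iio a) : Ordinal.{u})) '' {x | x < ⟨c, hc⟩} := by
      rintro _ ⟨⟨x, hx, rfl⟩, hlt⟩
      exact ⟨⟨x, hx⟩, hlt, rfl⟩
    exact (mk_le_mk_of_subset himg).trans mk_image_le

/-- Regularity of `μ` trades cardinality for unboundedness, the form in which the MAD family is
used. -/
theorem mem_fullSubsets_iff {μ : Cardinal.{u}} (hμ : μ.IsRegular) {A : Set Ordinal.{u}}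
    (hA : A ⊆ Iio μ.ord) : A ∈ fullSubsets μ ↔ ∀ η < μ.ord, ∃ ξ ∈ A, η ≤ ξ := by
  constructor
  · rintro ⟨-, h⟩ η hη
    by_contra! hc
    exact ((mk_le_mk_of_subset hc).trans_lt (mk_Iio_lt_lift hη)).ne h
  · intro h
    refine ⟨hA, le_antisymm ?_ ?_⟩
    · refine (mk_le_mk_of_subset hA).trans ?_
      rw [Cardinal.mk_Iio_ordinal, card_ord]
    · by_contra! hc
      obtain ⟨b, hb, hb'⟩ := hμ.exists_lt_of_mk_lt hc hA
      obtain ⟨ξ, hξ, hbξ⟩ := h b hb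
      exact (hb' ξ hξ).not_ge hbξ

/-! ### Clubs of order type `μ` and their intervals -/

/-- `S` is a club of order type `μ` in `α`, an ordinal of cofinality `μ`. -/
structure IsClubIn (μ : Cardinal.{u}) (α : Ordinal.{u}) (S : Set Ordinal.{u}) : Prop where
  regular : μ.IsRegular
  cof_eq : α.cof = μ
  subset : S ⊆ Iio α
  unbounded : ∀ β < α, ∃ c ∈ S, β < c
  closed : ∀ T ⊆ S, T.Nonempty → ∀ s < α, IsLUB T s → s ∈ S
  mk_lt : ∀ c ∈ S, #{x | x ∈ S ∧ x < c} < Cardinal.lift.{u + 1} μ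

theorem IsClubSeq.isClubIn {lam μ : Cardinal.{u}} {C : Ordinal.{u} → Set Ordinal.{u}}
    (hC : IsClubSeq lam μ C) (hμ : μ.IsRegular) {α : Ordinal.{u}} (hα : α < lam.ord)
    (hcof : α.cof = μ) : IsClubIn μ α (C α) := by
  obtain ⟨hsub, hclub, htype⟩ := hC α ⟨hα, hcof⟩
  refine ⟨hμ, hcof, hsub, fun β hβ => ?_, fun T hT hne s hs hlub => ?_, fun c hc => ?_⟩
  · have hlim : Order.IsSuccLimit α := by
      rw [← one_lt_cof_iff, hcof]
      exact one_lt_aleph0.trans_le hμ.aleph0_le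
    obtain ⟨⟨c, hc⟩, hcC, hle⟩ := hclub.isCofinal ⟨β + 1, hlim.add_one_lt hβ⟩
    exact ⟨c, hcC, (lt_add_one β).trans_le hle⟩
  · have hTα : ∀ x ∈ T, x < α := fun x hx => hsub (hT hx)
    have hlub' : IsLUB {x : Iio α | (x : Ordinal.{u}) ∈ T} ⟨s, hs⟩ :=
      ⟨fun x hx => hlub.1 hx, fun b hb => hlub.2 fun x hx => hb (a := ⟨x, hTα x hx⟩) hx⟩
    have hne' : {x : Iio α | (x : Ordinal.{u}) ∈ T}.Nonempty := by
      obtain ⟨x, hx⟩ := hne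
      exact ⟨⟨x, hTα x hx⟩, hx⟩
    have hmem := hclub.isLUB_mem (fun x hx => hT hx) hne' hlub'
    exact hmem
  · have h := typein_lt_type (fun x y : C α => x < y) ⟨c, hc⟩
    rw [htype, lift_ord, lt_ord, card_typein] at h
    refine lt_of_le_of_lt ?_ h
    refine mk_le_of_injective (f := fun x : {x | x ∈ C α ∧ x < c} => ⟨⟨x.1, x.2.1⟩, x.2.2⟩) ?_
    intro x y hxy
    simpa [Subtype.ext_iff] using hxy

theorem incEnum_eq (S : Set Ordinal.{u}) (ξ : Ordinal.{u}) :
    incEnum S ξ = sInf {a | a ∈ S ∧ ∀ ζ, ζ < ξ → incEnum S ζ < a} := by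
  rw [incEnum]

namespace IsClubIn

variable {μ : Cardinal.{u}} {α : Ordinal.{u}} {S : Set Ordinal.{u}} {ξ ζ : Ordinal.{u}}

theorem ord_pos (h : IsClubIn μ α S) : 0 < μ.ord := h.regular.ord_pos

theorem isSuccLimit_ord (h : IsClubIn μ α S) : Order.IsSuccLimit μ.ord :=
  Cardinal.isSuccLimit_ord h.regular.aleph0_le

theorem incEnum_spec (h : IsClubIn μ α S) (hξ : ξ < μ.ord) :
    incEnum S ξ ∈ S ∧ ∀ ζ, ζ < ξ → incEnum S ζ < incEnum S ξ := by
  induction ξ using WellFoundedLT.induction with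
  | ind ξ ih =>
    have hne : {a | a ∈ S ∧ ∀ ζ, ζ < ξ → incEnum S ζ < a}.Nonempty := by
      obtain ⟨b, hb, hb'⟩ := exists_lt_of_mk_lt_cof (s := incEnum S '' Iio ξ) (a := α)
        (by rw [h.cof_eq]; exact mk_image_le.trans_lt (mk_Iio_lt_lift hξ))
        (by
          rintro _ ⟨ζ, hζ, rfl⟩
          exact h.subset (ih ζ hζ (lt_trans hζ hξ)).1)
      obtain ⟨c, hc, hbc⟩ := h.unbounded b hb
      exact ⟨c, hc, fun ζ hζ => (hb' _ (mem_image_of_mem _ hζ)).trans hbc⟩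
    have := csInf_mem hne
    rwa [← incEnum_eq] at this

theorem incEnum_mem (h : IsClubIn μ α S) (hξ : ξ < μ.ord) : incEnum S ξ ∈ S :=
  (h.incEnum_spec hξ).1

theorem incEnum_lt (h : IsClubIn μ α S) (hξ : ξ < μ.ord) : incEnum S ξ < α :=
  h.subset (h.incEnum_mem hξ)

theorem incEnum_strictMono (h : IsClubIn μ α S) (hξ : ξ < μ.ord) (hζ : ζ < ξ) :
    incEnum S ζ < incEnum S ξ :=
  (h.incEnum_spec hξ).2 ζ hζ

theorem incEnum_mono (h : IsClubIn μ α S) (hξ : ξ < μ.ord) (hζ : ζ ≤ ξ) :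
    incEnum S ζ ≤ incEnum S ξ := by
  rcases hζ.eq_or_lt with rfl | hlt
  · exact le_rfl
  · exact (h.incEnum_strictMono hξ hlt).le

theorem incEnum_le {c : Ordinal.{u}} (hc : c ∈ S) (hlt : ∀ ζ, ζ < ξ → incEnum S ζ < c) :
    incEnum S ξ ≤ c := by
  rw [incEnum_eq]
  exact csInf_le' ⟨hc, hlt⟩

/-- If `c` were missed, all values with index below `μ.ord` would stay below `c`, embedding `μ` in a
proper initial segment of `S`. -/
theorem exists_incEnum_eq (h : IsClubIn μ α S) {c : Ordinal.{u}} (hc : c ∈ S) :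
    ∃ ξ < μ.ord, incEnum S ξ = c := by
  by_contra! hne
  have hlt : ∀ ξ < μ.ord, incEnum S ξ < c := by
    intro ξ
    induction ξ using WellFoundedLT.induction with
    | ind ξ ih =>
      exact fun hξ => (incEnum_le hc fun ζ hζ => ih ζ hζ (hζ.trans hξ)).lt_of_ne (hne ξ hξ)
  refine (h.mk_lt c hc).not_ge ?_
  have hle : #(Iio μ.ord) ≤ #{x | x ∈ S ∧ x < c} := by
    refine mk_le_of_injective
      (f := fun ξ : Iio μ.ord => ⟨incEnum S ξ, h.incEnum_mem ξ.2, hlt _ ξ.2⟩) ?_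
    intro x y hxy
    have hxy' : incEnum S x = incEnum S y := congrArg Subtype.val hxy
    rcases lt_trichotomy (x : Ordinal.{u}) y with hl | he | hl
    · exact absurd hxy' (h.incEnum_strictMono y.2 hl).ne
    · exact Subtype.ext he
    · exact absurd hxy' (h.incEnum_strictMono x.2 hl).ne'
  rwa [Cardinal.mk_Iio_ordinal, card_ord] at hle

theorem exists_lt_incEnum (h : IsClubIn μ α S) {β : Ordinal.{u}} (hβ : β < α) :
    ∃ ξ < μ.ord, β < incEnum S ξ := by
  obtain ⟨c, hc, hβc⟩ := h.unbounded β hβ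
  obtain ⟨ξ, hξ, rfl⟩ := h.exists_incEnum_eq hc
  exact ⟨ξ, hξ, hβc⟩

/-- The supremum of the earlier values lies in `S` by closedness, so the enumeration is continuous.
-/
theorem incEnum_le_of_isSuccLimit (h : IsClubIn μ α S) (hξ : ξ < μ.ord)
    (hlim : Order.IsSuccLimit ξ) {γ : Ordinal.{u}} (hγ : ∀ ζ < ξ, incEnum S ζ < γ) :
    incEnum S ξ ≤ γ := by
  have hne : (incEnum S '' Iio ξ).Nonempty := ⟨_, mem_image_of_mem _ (mem_Iio.2 hlim.bot_lt)⟩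
  have hbdd : ∀ b, (∀ ζ < ξ, incEnum S ζ < b) → b ∈ upperBounds (incEnum S '' Iio ξ) := by
    rintro b hb _ ⟨ζ, hζ, rfl⟩
    exact (hb ζ hζ).le
  have hlub := isLUB_csSup hne ⟨γ, hbdd γ hγ⟩
  have hlt : ∀ ζ < ξ, incEnum S ζ < sSup (incEnum S '' Iio ξ) := fun ζ hζ =>
    (h.incEnum_strictMono (hlim.add_one_lt hζ |>.trans hξ) (lt_add_one ζ)).trans_le
      (hlub.1 (mem_image_of_mem _ (hlim.add_one_lt hζ)))
  refine (incEnum_le (h.closed _ ?_ hne _ ?_ hlub) hlt).trans (hlub.2 (hbdd γ hγ))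
  · rintro _ ⟨ζ, hζ, rfl⟩
    exact h.incEnum_mem (lt_trans hζ hξ)
  · exact (hlub.2 (hbdd _ fun ζ hζ => h.incEnum_strictMono hξ hζ)).trans_lt (h.incEnum_lt hξ)

theorem mem_clubInterval_bounds {γ : Ordinal.{u}} (hγ : γ ∈ clubInterval S ξ) :
    incEnum S ξ ≤ γ ∧ γ ≤ incEnum S (ξ + 1) := by
  unfold clubInterval at hγ
  split_ifs at hγ
  · exact hγ
  · exact ⟨hγ.1.le, hγ.2⟩

theorem add_one_lt (h : IsClubIn μ α S) (hξ : ξ < μ.ord) : ξ + 1 < μ.ord :=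
  h.isSuccLimit_ord.add_one_lt hξ

theorem lt_of_mem_clubInterval (h : IsClubIn μ α S) (hξ : ξ < μ.ord) {γ : Ordinal.{u}}
    (hγ : γ ∈ clubInterval S ξ) : γ < α :=
  (mem_clubInterval_bounds hγ).2.trans_lt (h.incEnum_lt (h.add_one_lt hξ))

/-- Intervals at limit indices contain their left endpoint, but a limit index leaves room for a
strictly intermediate value. -/
theorem lt_of_mem_clubInterval_of_lt (h : IsClubIn μ α S) (hξ : ξ < μ.ord) (hζ : ζ < ξ)
    {γ δ : Ordinal.{u}} (hγ : γ ∈ clubInterval S ζ) (hδ : δ ∈ clubInterval S ξ) : γ < δ := by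
  have h1 := (mem_clubInterval_bounds hγ).2
  have h2 := h.incEnum_mono hξ (Order.add_one_le_of_lt hζ)
  unfold clubInterval at hδ
  split_ifs at hδ with hlim
  · exact h1.trans_lt ((h.incEnum_strictMono hξ (hlim.add_one_lt hζ)).trans_le hδ.1)
  · exact (h1.trans h2).trans_lt hδ.1

theorem eq_of_mem_clubInterval (h : IsClubIn μ α S) (hξ : ξ < μ.ord) (hζ : ζ < μ.ord)
    {γ : Ordinal.{u}} (hγ : γ ∈ clubInterval S ζ) (hδ : γ ∈ clubInterval S ξ) : ζ = ξ := by
  rcases lt_trichotomy ζ ξ with hl | he | hl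
  · exact absurd (h.lt_of_mem_clubInterval_of_lt hξ hl hγ hδ) (lt_irrefl _)
  · exact he
  · exact absurd (h.lt_of_mem_clubInterval_of_lt hζ hl hδ hγ) (lt_irrefl _)

/-- Take the least `ξ` with `γ ≤ incEnum S ξ`. At a successor, the preceding interval works; at a
limit, continuity makes `γ` the left endpoint, which is why limit intervals are closed on the left.
-/
theorem exists_mem_clubInterval (h : IsClubIn μ α S) {γ : Ordinal.{u}} (hγ : incEnum S 0 < γ)
    (hγα : γ < α) : ∃ ξ < μ.ord, γ ∈ clubInterval S ξ := by
  obtain ⟨ξ, hξ, hmin⟩ : ∃ ξ, γ ≤ incEnum S ξ ∧ ∀ ζ < ξ, incEnum S ζ < γ := by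
    obtain ⟨ξ, -, hξ⟩ := h.exists_lt_incEnum hγα
    have hne : {ξ | γ ≤ incEnum S ξ}.Nonempty := ⟨ξ, hξ.le⟩
    exact ⟨_, csInf_mem hne, fun ζ hζ => not_le.1 fun hle => notMem_of_lt_csInf' hζ hle⟩
  have hξμ : ξ < μ.ord := by
    obtain ⟨ζ, hζ, hlt⟩ := h.exists_lt_incEnum hγα
    exact lt_of_le_of_lt (not_lt.1 fun hl => (hmin ζ hl).not_gt hlt) hζ
  rcases zero_or_succ_or_isSuccLimit ξ with rfl | ⟨ζ, rfl⟩ | hlim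
  · exact absurd hξ hγ.not_ge
  · have hζ : ζ < ζ + 1 := lt_add_one ζ
    refine ⟨ζ, hζ.trans hξμ, ?_⟩
    unfold clubInterval
    split_ifs
    · exact ⟨(hmin ζ hζ).le, hξ⟩
    · exact ⟨hmin ζ hζ, hξ⟩
  · refine ⟨ξ, hξμ, ?_⟩
    rw [clubInterval, if_pos hlim]
    have he := le_antisymm hξ (h.incEnum_le_of_isSuccLimit hξμ hlim hmin)
    exact ⟨he.ge, he.trans_le (h.incEnum_mono (h.add_one_lt hξμ) (lt_add_one ξ).le)⟩

end IsClubIn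

/-! ### Accumulation of sets of ordinals -/

theorem exists_mad_frequently {μ : Cardinal.{u}} (hμ : μ.IsRegular) {κ : Ordinal.{u}}
    {M : Ordinal.{u} → Set Ordinal.{u}} (hM : IsMADFamily μ (M '' Iio κ)) {A : Set Ordinal.{u}}
    (hA : A ∈ fullSubsets μ) : ∃ φ < κ, ∀ η < μ.ord, ∃ ξ ∈ A, ξ ∈ M φ ∧ η ≤ ξ := by
  obtain ⟨_, ⟨φ, hφ, rfl⟩, h⟩ := hM.maximal A hA
  refine ⟨φ, hφ, fun η hη => ?_⟩
  have hsub : A ∩ M φ ⊆ Iio μ.ord := fun x hx => hA.1 hx.1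
  obtain ⟨ξ, hξ, hle⟩ := (mem_fullSubsets_iff hμ hsub).1 ⟨hsub, h⟩ η hη
  exact ⟨ξ, hξ.1, hξ.2, hle⟩

/-- The indices of intervals meeting `Γ` are unbounded in `μ`, so maximality applies to the set of
these indices. -/
theorem IsClubIn.exists_mad_frequently {μ : Cardinal.{u}} {α : Ordinal.{u}} {S : Set Ordinal.{u}}
    (h : IsClubIn μ α S) {κ : Ordinal.{u}} {M : Ordinal.{u} → Set Ordinal.{u}}
    (hM : IsMADFamily μ (M '' Iio κ)) {Γ : Set Ordinal.{u}} (hΓ : ∀ γ ∈ Γ, γ < α)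
    (hunb : ∀ β < α, ∃ γ ∈ Γ, β < γ) :
    ∃ φ < κ, ∀ η < μ.ord, ∃ ξ ∈ M φ, η ≤ ξ ∧ ∃ γ ∈ Γ, γ ∈ clubInterval S ξ := by
  obtain ⟨φ, hφ, hf⟩ := _root_.exists_mad_frequently h.regular hM
    (A := {ξ | ξ < μ.ord ∧ ∃ γ ∈ Γ, γ ∈ clubInterval S ξ}) (by
      rw [mem_fullSubsets_iff h.regular fun ξ hξ => hξ.1]
      intro η hη
      obtain ⟨γ, hγ, hlt⟩ := hunb _ (h.incEnum_lt (h.add_one_lt hη))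
      obtain ⟨ξ, hξ, hmem⟩ := h.exists_mem_clubInterval
        ((h.incEnum_mono (h.add_one_lt hη) zero_le).trans_lt hlt) (hΓ γ hγ)
      refine ⟨ξ, ⟨hξ, γ, hγ, hmem⟩, ?_⟩
      by_contra! hlt'
      have h1 := (IsClubIn.mem_clubInterval_bounds hmem).2
      have h2 := h.incEnum_mono (h.add_one_lt hη)
        (Order.add_one_le_of_lt (hlt'.trans (lt_add_one η)))
      exact (h1.trans h2).not_gt hlt)
  refine ⟨φ, hφ, fun η hη => ?_⟩
  obtain ⟨ξ, ⟨-, hγ⟩, hξ, hle⟩ := hf η hη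
  exact ⟨ξ, hξ, hle, hγ⟩

/-- Take the least `α` below which `Γ` has `μ` elements. A larger cofinality would bound `μ` of them
below `α`; a smaller one would write `Γ ∩ Iio α` as a union of fewer than `μ` sets of size less than
`μ`. The hypothesis on `lam` excludes `α = lam.ord`. -/
theorem exists_cofSet_limit {lam μ : Cardinal.{u}} (hμ : μ.IsRegular) (hcof : μ < lam.ord.cof)
    {Γ : Set Ordinal.{u}} (hΓ : ∀ γ ∈ Γ, γ < lam.ord) (hcard : Cardinal.lift.{u + 1} μ ≤ #Γ) :
    ∃ α < lam.ord, α.cof = μ ∧ ∀ β < α, ∃ γ ∈ Γ, γ < α ∧ β < γ := by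
  have hinf : ℵ₀ ≤ Cardinal.lift.{u + 1} μ := aleph0_le_lift.2 hμ.aleph0_le
  have hne : {α | Cardinal.lift.{u + 1} μ ≤ #(Γ ∩ Iio α : Set Ordinal.{u})}.Nonempty :=
    ⟨lam.ord, by rwa [mem_ofPred_eq, inter_eq_left.2 (show Γ ⊆ Iio lam.ord from hΓ)]⟩
  obtain ⟨α, hα, hmin⟩ : ∃ α, Cardinal.lift.{u + 1} μ ≤ #(Γ ∩ Iio α : Set Ordinal.{u}) ∧
      ∀ β < α, #(Γ ∩ Iio β : Set Ordinal.{u}) < Cardinal.lift.{u + 1} μ :=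
    ⟨_, csInf_mem hne, fun β hβ => not_le.1 fun hle => notMem_of_lt_csInf' hβ hle⟩
  have hle : α ≤ lam.ord := by
    by_contra! hlt
    exact (hmin _ hlt).not_ge (by rwa [inter_eq_left.2 (show Γ ⊆ Iio lam.ord from hΓ)])
  have hmin' : ∀ β < α, #(Γ ∩ Iic β : Set Ordinal.{u}) < Cardinal.lift.{u + 1} μ := by
    intro β hβ
    refine lt_of_le_of_lt (mk_le_mk_of_subset (t := (Γ ∩ Iio β) ∪ {β}) ?_) ?_
    · rintro γ ⟨hγ, hle⟩
      rcases (mem_Iic.1 hle).eq_or_lt with rfl | hlt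
      · exact Or.inr rfl
      · exact Or.inl ⟨hγ, hlt⟩
    · refine (mk_union_le _ _).trans_lt (add_lt_of_lt hinf (hmin β hβ) ?_)
      rw [mk_singleton]
      exact one_lt_aleph0.trans_le hinf
  have hunb : ∀ β < α, ∃ γ ∈ Γ, γ < α ∧ β < γ := by
    intro β hβ
    by_contra! hc
    exact (hmin' β hβ).not_ge (hα.trans (mk_le_mk_of_subset fun γ hγ => ⟨hγ.1, hc γ hγ.1 hγ.2⟩))
  have hcofα : α.cof = μ := by
    apply le_antisymm
    · by_contra! hlt
      obtain ⟨p, hp, hpc⟩ := le_mk_iff_exists_subset.1 hα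
      obtain ⟨b, hb, hb'⟩ := exists_lt_of_mk_lt_cof (s := p) (a := α)
        (by rwa [hpc, Cardinal.lift_lt]) (fun i hi => (hp hi).2)
      exact (hmin b hb).not_ge
        (hpc.ge.trans (mk_le_mk_of_subset fun i hi => ⟨(hp hi).1, hb' i hi⟩))
    · by_contra! hlt
      obtain ⟨s, hs, hsc, hsu, -⟩ := exists_unbounded_of_cof α
      refine hα.not_gt (lt_of_le_of_lt (mk_le_mk_of_subset
        (t := ⋃ b ∈ s, Γ ∩ Iic b) ?_) ?_)
      · rintro γ ⟨hγ, hγα⟩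
        obtain ⟨i, hi, hle⟩ := hsu γ hγα
        exact mem_biUnion hi ⟨hγ, hle⟩
      · rw [card_biUnion_lt_iff_forall_of_isRegular hμ.lift (by rwa [hsc, Cardinal.lift_lt])]
        exact fun b hb => hmin' b (hs hb)
  refine ⟨α, hle.lt_of_ne ?_, hcofα, hunb⟩
  rintro rfl
  exact hcof.ne' hcofα

/-! ### Neighbourhood bases and the topology -/

/-- The standing assumptions on the parameters of a club space. -/
structure ClubSpaceData (lam μ : Cardinal.{u}) (κ : Ordinal.{u})
    (M C : Ordinal.{u} → Set Ordinal.{u}) : Prop where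
  regular : μ.IsRegular
  mad : IsMADFamily μ (M '' Iio κ)
  injOn : InjOn M (Iio κ)
  clubSeq : IsClubSeq lam μ C

namespace ClubSpace

variable {lam μ : Cardinal.{u}} {κ : Ordinal.{u}} {M C : Ordinal.{u} → Set Ordinal.{u}}

theorem fst_lt (x : ClubSpace lam μ κ M C) : x.fst < lam.ord := x.2.1

theorem snd_lt (x : ClubSpace lam μ κ M C) : x.snd < κ := x.2.2.1

theorem snd_eq_zero {x : ClubSpace lam μ κ M C} (h : x.fst.cof ≠ μ) : x.snd = 0 := x.2.2.2 h

theorem ext {x y : ClubSpace lam μ κ M C} (h : x.fst = y.fst) (h' : x.snd = y.snd) : x = y :=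
  Subtype.ext (Prod.ext h h')

theorem eq_of_fst_eq {x y : ClubSpace lam μ κ M C} (hx : x.fst.cof ≠ μ) (h : y.fst = x.fst) :
    y = x :=
  ext h ((snd_eq_zero (h ▸ hx)).trans (snd_eq_zero hx).symm)

/-- The point `(α, φ)`, for `α` of cofinality `μ`. -/
def point {α φ : Ordinal.{u}} (hα : α < lam.ord) (hφ : φ < κ) (hcof : α.cof = μ) :
    ClubSpace lam μ κ M C :=
  ⟨(α, φ), hα, hφ, fun h => absurd hcof h⟩

theorem mem_nhdBase_of_eq {x : ClubSpace lam μ κ M C} (hx : x.fst.cof = μ)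
    {B : Set (ClubSpace lam μ κ M C)} : B ∈ nhdBase x ↔ ∃ η < μ.ord, B = nhdMid x η := by
  simp [nhdBase, hx]

theorem mem_nhdBase_of_gt {x : ClubSpace lam μ κ M C} (hx : μ < x.fst.cof)
    {B : Set (ClubSpace lam μ κ M C)} : B ∈ nhdBase x ↔ ∃ β < x.fst, B = nhdHigh x β := by
  simp [nhdBase, hx, hx.ne', hx.not_gt]

theorem mem_nhdBase_of_lt {x : ClubSpace lam μ κ M C} (hx : x.fst.cof < μ)
    {B : Set (ClubSpace lam μ κ M C)} : B ∈ nhdBase x ↔ B = {x} := by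
  simp [nhdBase, hx, hx.ne, hx.not_gt]

theorem mem_of_mem_nhdBase {x : ClubSpace lam μ κ M C} {B : Set (ClubSpace lam μ κ M C)}
    (hB : B ∈ nhdBase x) : x ∈ B := by
  rcases hB with ⟨-, η, -, rfl⟩ | ⟨-, β, hβ, rfl⟩ | ⟨-, rfl⟩
  · exact Or.inl rfl
  · exact ⟨hβ, le_rfl⟩
  · exact rfl

theorem nhdMid_anti (x : ClubSpace lam μ κ M C) {η η' : Ordinal.{u}} (h : η ≤ η') :
    nhdMid x η' ⊆ nhdMid x η :=
  union_subset_union_right _ fun _ ⟨ξ, hξ, hle, hy⟩ => ⟨ξ, hξ, h.trans hle, hy⟩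

theorem nhdHigh_anti (x : ClubSpace lam μ κ M C) {β β' : Ordinal.{u}} (h : β ≤ β') :
    nhdHigh x β' ⊆ nhdHigh x β :=
  fun _ hy => ⟨h.trans_lt hy.1, hy.2⟩

/-- Each base is a singleton or a chain decreasing along an ordinal of cofinality at least `μ`. -/
theorem exists_nhdBase_subset (hμ : μ.IsRegular) (x : ClubSpace lam μ κ M C) {ι : Type (u + 1)}
    (hι : #ι < Cardinal.lift.{u + 1} μ) {B : ι → Set (ClubSpace lam μ κ M C)}
    (hB : ∀ i, B i ∈ nhdBase x) : ∃ B' ∈ nhdBase x, ∀ i, B' ⊆ B i := by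
  rcases lt_trichotomy x.fst.cof μ with hx | hx | hx
  · refine ⟨{x}, (mem_nhdBase_of_lt hx).2 rfl, fun i => ?_⟩
    rw [(mem_nhdBase_of_lt hx).1 (hB i)]
  · choose η hη hBη using fun i => (mem_nhdBase_of_eq hx).1 (hB i)
    obtain ⟨b, hb, hb'⟩ := hμ.exists_lt_of_mk_lt (s := range η) (mk_range_le.trans_lt hι)
      (by rintro _ ⟨i, rfl⟩; exact hη i)
    refine ⟨nhdMid x b, (mem_nhdBase_of_eq hx).2 ⟨b, hb, rfl⟩, fun i => ?_⟩
    rw [hBη i]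
    exact nhdMid_anti x (hb' _ (mem_range_self i)).le
  · choose η hη hBη using fun i => (mem_nhdBase_of_gt hx).1 (hB i)
    obtain ⟨b, hb, hb'⟩ := exists_lt_of_mk_lt_cof (s := range η) (a := x.fst)
      (mk_range_le.trans_lt (hι.trans (Cardinal.lift_lt.2 hx)))
      (by rintro _ ⟨i, rfl⟩; exact hη i)
    refine ⟨nhdHigh x b, (mem_nhdBase_of_gt hx).2 ⟨b, hb, rfl⟩, fun i => ?_⟩
    rw [hBη i]
    exact nhdHigh_anti x (hb' _ (mem_range_self i)).le

theorem mem_iInf_nhdBase (hμ : μ.IsRegular) {x : ClubSpace lam μ κ M C}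
    {s : Set (ClubSpace lam μ κ M C)} :
    s ∈ ⨅ B ∈ nhdBase x, Filter.principal B ↔ ∃ B ∈ nhdBase x, B ⊆ s := by
  have hinf : ℵ₀ ≤ Cardinal.lift.{u + 1} μ := aleph0_le_lift.2 hμ.aleph0_le
  rw [Filter.mem_biInf_of_directed]
  · simp
  · intro B hB B' hB'
    obtain ⟨D, hD, hDB⟩ := exists_nhdBase_subset hμ x (ι := ULift Bool)
      (B := fun i => if i.down then B else B') ((lt_aleph0_of_finite _).trans_le hinf)
      (by rintro ⟨_ | _⟩ <;> simpa)
    refine ⟨D, hD, ?_, ?_⟩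
    · simpa using hDB ⟨true⟩
    · simpa using hDB ⟨false⟩
  · obtain ⟨D, hD, -⟩ := exists_nhdBase_subset hμ x (ι := PEmpty)
      (B := fun i => i.elim) ((lt_aleph0_of_finite _).trans_le hinf) (fun i => i.elim)
    exact ⟨D, hD⟩

theorem isOpen_iff (hμ : μ.IsRegular) {s : Set (ClubSpace lam μ κ M C)} :
    IsOpen s ↔ ∀ x ∈ s, ∃ B ∈ nhdBase x, B ⊆ s :=
  forall₂_congr fun _ _ => mem_iInf_nhdBase hμ

theorem isOpen_iInter (hμ : μ.IsRegular) {ι : Type (u + 1)} (hι : #ι < Cardinal.lift.{u + 1} μ)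
    {s : ι → Set (ClubSpace lam μ κ M C)} (hs : ∀ i, IsOpen (s i)) : IsOpen (⋂ i, s i) := by
  rw [isOpen_iff hμ]
  intro x hx
  choose B hB hBs using fun i => (isOpen_iff hμ).1 (hs i) x (mem_iInter.1 hx i)
  obtain ⟨B', hB', hsub⟩ := exists_nhdBase_subset hμ x hι hB
  exact ⟨B', hB', subset_iInter fun i => (hsub i).trans (hBs i)⟩

theorem isClosed_iUnion (hμ : μ.IsRegular) {ι : Type (u + 1)} (hι : #ι < Cardinal.lift.{u + 1} μ)
    {s : ι → Set (ClubSpace lam μ κ M C)} (hs : ∀ i, IsClosed (s i)) : IsClosed (⋃ i, s i) := by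
  rw [← isOpen_compl_iff, compl_iUnion]
  exact isOpen_iInter hμ hι fun i => (hs i).isOpen_compl

variable (h : ClubSpaceData lam μ κ M C)
include h

theorem isClubIn {x : ClubSpace lam μ κ M C} (hx : x.fst.cof = μ) :
    IsClubIn μ x.fst (C x.fst) :=
  h.clubSeq.isClubIn h.regular x.fst_lt hx

theorem lt_of_mem_M {x : ClubSpace lam μ κ M C} {ξ : Ordinal.{u}} (hξ : ξ ∈ M x.snd) :
    ξ < μ.ord :=
  (h.mad.subset (mem_image_of_mem M x.snd_lt)).1 hξ

theorem fst_lt_of_mem_nhdMid {x y : ClubSpace lam μ κ M C} (hx : x.fst.cof = μ) {η : Ordinal.{u}}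
    (hy : y ∈ nhdMid x η) (hne : y ≠ x) : y.fst < x.fst := by
  rcases hy with hy | ⟨ξ, hξ, -, hy⟩
  · exact absurd hy hne
  · exact (isClubIn h hx).lt_of_mem_clubInterval (lt_of_mem_M h hξ) hy

theorem exists_nhdBase_le (x : ClubSpace lam μ κ M C) {β : Ordinal.{u}} (hβ : β < x.fst) :
    ∃ B ∈ nhdBase x, ∀ y ∈ B, β < y.fst := by
  rcases lt_trichotomy x.fst.cof μ with hx | hx | hx
  · refine ⟨{x}, (mem_nhdBase_of_lt hx).2 rfl, ?_⟩
    rintro y rfl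
    exact hβ
  · obtain ⟨η, hη, hlt⟩ := (isClubIn h hx).exists_lt_incEnum hβ
    refine ⟨nhdMid x η, (mem_nhdBase_of_eq hx).2 ⟨η, hη, rfl⟩, ?_⟩
    rintro y (rfl | ⟨ξ, hξ, hle, hy⟩)
    · exact hβ
    · exact hlt.trans_le (((isClubIn h hx).incEnum_mono (lt_of_mem_M h hξ) hle).trans
        (IsClubIn.mem_clubInterval_bounds hy).1)
  · exact ⟨nhdHigh x β, (mem_nhdBase_of_gt hx).2 ⟨β, hβ, rfl⟩, fun y hy => hy.1⟩

theorem le_of_mem_nhdBase {x y : ClubSpace lam μ κ M C} {B : Set (ClubSpace lam μ κ M C)}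
    (hB : B ∈ nhdBase x) (hy : y ∈ B) : y.fst ≤ x.fst := by
  rcases hB with ⟨hx, η, -, rfl⟩ | ⟨-, β, hβ, rfl⟩ | ⟨-, rfl⟩
  · rcases eq_or_ne y x with rfl | hne
    · exact le_rfl
    · exact (fst_lt_of_mem_nhdMid h hx hy hne).le
  · exact hy.2
  · rw [mem_singleton_iff.1 hy]

theorem exists_mem_nhdBase (x : ClubSpace lam μ κ M C) : ∃ B, B ∈ nhdBase x := by
  obtain ⟨B, hB, -⟩ := (isOpen_iff h.regular).1 isOpen_univ x (mem_univ x)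
  exact ⟨B, hB⟩

/-! ### Clopen base, separation and scatteredness -/

theorem isOpen_Ioi (β : Ordinal.{u}) : IsOpen {y : ClubSpace lam μ κ M C | β < y.fst} :=
  (isOpen_iff h.regular).2 fun x hx => exists_nhdBase_le h x hx

theorem isOpen_Iic (β : Ordinal.{u}) : IsOpen {y : ClubSpace lam μ κ M C | y.fst ≤ β} := by
  refine (isOpen_iff h.regular).2 fun x hx => ?_
  obtain ⟨B, hB⟩ := exists_mem_nhdBase h x
  exact ⟨B, hB, fun y hy => (le_of_mem_nhdBase h hB hy).trans hx⟩

theorem isOpen_Iio (β : Ordinal.{u}) : IsOpen {y : ClubSpace lam μ κ M C | y.fst < β} := by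
  refine (isOpen_iff h.regular).2 fun x hx => ?_
  obtain ⟨B, hB⟩ := exists_mem_nhdBase h x
  exact ⟨B, hB, fun y hy => (le_of_mem_nhdBase h hB hy).trans_lt hx⟩

theorem isClopen_Iic (β : Ordinal.{u}) : IsClopen {y : ClubSpace lam μ κ M C | y.fst ≤ β} := by
  refine ⟨⟨?_⟩, isOpen_Iic h β⟩
  convert isOpen_Ioi h β using 1
  ext y
  simp

theorem isClopen_Ioi (β : Ordinal.{u}) : IsClopen {y : ClubSpace lam μ κ M C | β < y.fst} := by
  convert (isClopen_Iic h β).compl using 1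
  ext y
  simp

theorem isClosed_Ici (β : Ordinal.{u}) : IsClosed {y : ClubSpace lam μ κ M C | β ≤ y.fst} := by
  refine ⟨?_⟩
  convert isOpen_Iio h β using 1
  ext y
  simp

theorem isClopen_clubInterval {x : ClubSpace lam μ κ M C} (hx : x.fst.cof = μ) {ξ : Ordinal.{u}}
    (hξ : ξ < μ.ord) :
    IsClopen {y : ClubSpace lam μ κ M C | y.fst ∈ clubInterval (C x.fst) ξ} := by
  have hc := isClubIn h hx
  unfold clubInterval
  split_ifs with hlim
  · refine ⟨(isClosed_Ici h _).inter (isClopen_Iic h _).1, ?_⟩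
    refine IsOpen.inter (s := {y | incEnum (C x.fst) ξ ≤ y.fst}) ?_ (isOpen_Iic h _)
    -- By continuity of the enumeration, the closed left end is an intersection of fewer than `μ`
    -- open rays.
    convert isOpen_iInter h.regular (mk_Iio_lt_lift hξ)
      (fun ζ : Iio ξ => isOpen_Ioi h (incEnum (C x.fst) ζ)) using 1
    ext y
    simp only [mem_iInter, Subtype.forall]
    exact ⟨fun hy ζ hζ => (hc.incEnum_strictMono hξ hζ).trans_le hy,
      fun hy => hc.incEnum_le_of_isSuccLimit hξ hlim hy⟩
  · exact (isClopen_Ioi h _).inter (isClopen_Iic h _)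

theorem isOpen_nhdMid {x : ClubSpace lam μ κ M C} (hx : x.fst.cof = μ) {η : Ordinal.{u}}
    (hη : η < μ.ord) : IsOpen (nhdMid x η) := by
  refine (isOpen_iff h.regular).2 ?_
  rintro y (rfl | ⟨ξ, hξ, hle, hy⟩)
  · exact ⟨_, (mem_nhdBase_of_eq hx).2 ⟨η, hη, rfl⟩, subset_rfl⟩
  · obtain ⟨B, hB, hsub⟩ := (isOpen_iff h.regular).1
      (isClopen_clubInterval h hx (lt_of_mem_M h hξ)).2 y hy
    exact ⟨B, hB, fun z hz => Or.inr ⟨ξ, hξ, hle, hsub hz⟩⟩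

theorem isOpen_of_mem_nhdBase {x : ClubSpace lam μ κ M C} {B : Set (ClubSpace lam μ κ M C)}
    (hB : B ∈ nhdBase x) : IsOpen B := by
  rcases hB with ⟨hx, η, hη, rfl⟩ | ⟨-, β, hβ, rfl⟩ | ⟨hx, rfl⟩
  · exact isOpen_nhdMid h hx hη
  · exact (isOpen_Ioi h β).inter (isOpen_Iic h x.fst)
  · refine (isOpen_iff h.regular).2 ?_
    rintro y rfl
    exact ⟨_, (mem_nhdBase_of_lt hx).2 rfl, subset_rfl⟩

/-- Almost disjointness bounds `M y.snd ∩ M x.snd` below `μ`; beyond the bound the two points use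
different, hence disjoint, intervals. -/
theorem exists_nhdMid_disjoint {x y : ClubSpace lam μ κ M C} (hx : x.fst.cof = μ)
    (hxy : y.fst = x.fst) (hne : y ≠ x) :
    ∃ η < μ.ord, ∀ z ∈ nhdMid y η, z ∉ nhdMid x 0 := by
  have hy : y.fst.cof = μ := hxy ▸ hx
  have hsnd : M y.snd ≠ M x.snd := fun he => hne (ext hxy (h.injOn y.snd_lt x.snd_lt he))
  obtain ⟨b, hb, hb'⟩ := h.regular.exists_lt_of_mk_lt
    (h.mad.almostDisjoint _ (mem_image_of_mem M y.snd_lt) _ (mem_image_of_mem M x.snd_lt) hsnd)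
    (fun i hi => lt_of_mem_M h hi.1)
  refine ⟨b, hb, ?_⟩
  rintro z (rfl | ⟨ξ, hξ, hle, hz⟩) (hzx | ⟨ζ, hζ, -, hz'⟩)
  · exact hne hzx
  · exact ((isClubIn h hx).lt_of_mem_clubInterval (lt_of_mem_M h hζ) hz').ne hxy
  · exact ((isClubIn h hy).lt_of_mem_clubInterval (lt_of_mem_M h hξ) hz).ne
      (by rw [mem_singleton_iff.1 hzx, hxy])
  · rw [hxy] at hz
    obtain rfl := (isClubIn h hx).eq_of_mem_clubInterval (lt_of_mem_M h hζ)
      (lt_of_mem_M h hξ) hz hz'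
    exact (hb' _ ⟨hξ, hζ⟩).not_ge hle

theorem isClosed_nhdMid {x : ClubSpace lam μ κ M C} (hx : x.fst.cof = μ) (η : Ordinal.{u}) :
    IsClosed (nhdMid x η) := by
  have hc := isClubIn h hx
  refine ⟨isOpen_iff_forall_mem_open.2 fun y hy => ?_⟩
  rcases lt_trichotomy y.fst x.fst with hlt | heq | hlt
  · rcases le_or_gt y.fst (incEnum (C x.fst) 0) with hle | hgt
    · refine ⟨{z | z.fst ≤ incEnum (C x.fst) 0}, ?_, isOpen_Iic h _, hle⟩
      rintro z hz (rfl | ⟨ξ, hξ, hηξ, hzξ⟩)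
      · exact hz.not_gt (hc.incEnum_lt hc.ord_pos)
      · refine hy (Or.inr ⟨ξ, hξ, hηξ, ?_⟩)
        have h1 := (hc.incEnum_mono (lt_of_mem_M h hξ) zero_le).trans
          (IsClubIn.mem_clubInterval_bounds hzξ).1
        have h0 : z.fst = incEnum (C x.fst) 0 := le_antisymm hz h1
        by_cases hξ0 : ξ = 0
        -- Index `0` is not a limit here, so its interval omits `incEnum (C x.fst) 0`.
        · subst hξ0
          rw [clubInterval, if_neg (fun hl => hl.ne_bot rfl)] at hzξ
          exact absurd hzξ.1 (not_lt.2 hz)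
        · exact absurd ((hc.incEnum_strictMono (lt_of_mem_M h hξ)
            (pos_iff_ne_zero.2 hξ0)).trans_le (IsClubIn.mem_clubInterval_bounds hzξ).1)
            (not_lt.2 hz)
    · obtain ⟨ζ, hζ, hyζ⟩ := hc.exists_mem_clubInterval hgt hlt
      refine ⟨_, ?_, (isClopen_clubInterval h hx hζ).2, hyζ⟩
      rintro z hz (rfl | ⟨ξ, hξ, hηξ, hzξ⟩)
      · exact (hc.lt_of_mem_clubInterval hζ hz).false
      · obtain rfl := hc.eq_of_mem_clubInterval hζ (lt_of_mem_M h hξ) hzξ hz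
        exact hy (Or.inr ⟨ξ, hξ, hηξ, hyζ⟩)
  · have hne : y ≠ x := by
      rintro rfl
      exact hy (Or.inl rfl)
    obtain ⟨b, hb, hdisj⟩ := exists_nhdMid_disjoint h hx heq hne
    exact ⟨nhdMid y b, fun z hz hzx => hdisj z hz (nhdMid_anti x zero_le hzx),
      isOpen_nhdMid h (heq ▸ hx) hb, Or.inl rfl⟩
  · refine ⟨{z | x.fst < z.fst}, fun z hz hzx => ?_, isOpen_Ioi h _, hlt⟩
    rcases eq_or_ne z x with rfl | hne
    · exact lt_irrefl z.fst hz
    · exact lt_asymm hz (fst_lt_of_mem_nhdMid h hx hzx hne)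

theorem isClopen_singleton {x : ClubSpace lam μ κ M C} (hx : x.fst.cof < μ) :
    IsClopen {x} := by
  have ho : IsOpen {x} := isOpen_of_mem_nhdBase h ((mem_nhdBase_of_lt hx).2 rfl)
  refine ⟨?_, ho⟩
  convert (isClosed_Ici h x.fst).inter (isClopen_Iic h x.fst).1 using 1
  ext y
  constructor
  · rintro rfl
    exact ⟨le_refl y.fst, le_refl y.fst⟩
  · exact fun hy => eq_of_fst_eq hx.ne (le_antisymm hy.2 hy.1)

theorem isClopen_of_mem_nhdBase {x : ClubSpace lam μ κ M C} {B : Set (ClubSpace lam μ κ M C)}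
    (hB : B ∈ nhdBase x) : IsClopen B := by
  refine ⟨?_, isOpen_of_mem_nhdBase h hB⟩
  rcases hB with ⟨hx, η, hη, rfl⟩ | ⟨-, β, hβ, rfl⟩ | ⟨hx, rfl⟩
  · exact isClosed_nhdMid h hx η
  · exact (isClopen_Ioi h β).1.inter (isClopen_Iic h x.fst).1
  · exact (isClopen_singleton h hx).1

theorem zeroDim : ZeroDim (ClubSpace lam μ κ M C) := by
  refine TopologicalSpace.isTopologicalBasis_of_isOpen_of_nhds (fun s hs => hs.2) ?_
  intro x s hx hs
  obtain ⟨B, hB, hsub⟩ := (isOpen_iff h.regular).1 hs x hx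
  exact ⟨B, isClopen_of_mem_nhdBase h hB, mem_of_mem_nhdBase hB, hsub⟩

theorem t2Space : T2Space (ClubSpace lam μ κ M C) := by
  suffices hsep : ∀ x y : ClubSpace lam μ κ M C, x.fst ≤ y.fst → x ≠ y →
      ∃ s, IsClopen s ∧ x ∉ s ∧ y ∈ s by
    refine ⟨fun x y hne => ?_⟩
    rcases le_total x.fst y.fst with hle | hle
    · obtain ⟨s, hs, hx, hy⟩ := hsep x y hle hne
      exact ⟨sᶜ, s, hs.compl.2, hs.2, hx, hy, disjoint_compl_left⟩
    · obtain ⟨s, hs, hx, hy⟩ := hsep y x hle hne.symm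
      exact ⟨s, sᶜ, hs.2, hs.compl.2, hy, hx, disjoint_compl_right⟩
  intro x y hle hne
  rcases hle.lt_or_eq with hlt | heq
  · exact ⟨_, isClopen_Ioi h x.fst, lt_irrefl x.fst, hlt⟩
  · have hy : y.fst.cof = μ := by
      by_contra hy
      exact hne (eq_of_fst_eq hy heq)
    refine ⟨nhdMid y 0, ⟨isClosed_nhdMid h hy 0, isOpen_nhdMid h hy h.regular.ord_pos⟩, ?_,
      Or.inl rfl⟩
    exact fun hx => (fst_lt_of_mem_nhdMid h hy hx hne).ne heq

theorem exists_isOpen_isolating (x : ClubSpace lam μ κ M C) :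
    ∃ U, IsOpen U ∧ x ∈ U ∧ ∀ y ∈ U, y ≠ x → y.fst < x.fst := by
  by_cases hx : x.fst.cof = μ
  · exact ⟨_, isOpen_nhdMid h hx h.regular.ord_pos, Or.inl rfl,
      fun y hy => fst_lt_of_mem_nhdMid h hx hy⟩
  · exact ⟨_, isOpen_Iic h x.fst, le_refl x.fst,
      fun y hy hne => lt_of_le_of_ne hy fun he => hne (eq_of_fst_eq hx he)⟩

theorem scatteredSpace : ScatteredSpace (ClubSpace lam μ κ M C) := by
  intro S hS
  obtain ⟨x, hx, hmin⟩ := WellFounded.has_min (InvImage.wf (fst (M := M) (C := C))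
    (wellFounded_lt (α := Ordinal.{u}))) S hS
  obtain ⟨U, hU, hxU, hlt⟩ := exists_isOpen_isolating h x
  refine ⟨x, hx, U, hU, ?_⟩
  ext y
  constructor
  · rintro ⟨hyU, hyS⟩
    by_contra hne
    exact hmin y hyS (hlt y hyU hne)
  · rintro rfl
    exact ⟨hxU, hx⟩

end ClubSpace

/-! ### Closed discrete kernels -/

theorem closedDiscrete_iff_forall_subset {X : Type v} [TopologicalSpace X] {A : Set X} :
    ClosedDiscrete A ↔ ∀ B ⊆ A, IsClosed B := by
  constructor
  · rintro ⟨hA, hd⟩ B hB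
    obtain ⟨U, hU, rfl⟩ := isDiscrete_iff_forall_mem_exists_isClosed.1 hd B hB
    exact hU.inter hA
  · intro h
    exact ⟨h A subset_rfl, isDiscrete_iff_forall_mem_exists_isClosed.2 fun B hB =>
      ⟨B, h B hB, inter_eq_left.2 hB⟩⟩

/-- `F` is covered by members of `𝒰` chosen along a closed discrete subset of `F`. -/
def HasKernel {X : Type v} [TopologicalSpace X] (𝒰 : Set (Set X)) (F : Set X) : Prop :=
  ∃ A ⊆ F, ClosedDiscrete A ∧ ∃ φ : X → Set X,
    (∀ a ∈ A, φ a ∈ 𝒰 ∧ a ∈ φ a) ∧ ∀ x ∈ F, ∃ a ∈ A, x ∈ φ a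

theorem HasKernel.of_subsingleton {X : Type v} [TopologicalSpace X] [T1Space X] {𝒰 : Set (Set X)}
    (h𝒰 : ⋃₀ 𝒰 = Set.univ) {F : Set X} (hF : F.Subsingleton) : HasKernel 𝒰 F := by
  choose φ hφ using fun x : X => mem_sUnion.1 (h𝒰.ge (mem_univ x))
  exact ⟨F, subset_rfl, ⟨hF.isClosed, hF.isDiscrete⟩, φ, fun a _ => hφ a,
    fun x hx => ⟨x, hx, (hφ x).2⟩⟩

namespace ClubSpace

variable {lam μ : Cardinal.{u}} {κ : Ordinal.{u}} {M C : Ordinal.{u} → Set Ordinal.{u}}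

theorem closedDiscrete_iUnion (hμ : μ.IsRegular) {ι : Type (u + 1)}
    (hι : #ι < Cardinal.lift.{u + 1} μ) {A : ι → Set (ClubSpace lam μ κ M C)}
    (hA : ∀ i, ClosedDiscrete (A i)) : ClosedDiscrete (⋃ i, A i) := by
  refine closedDiscrete_iff_forall_subset.2 fun B hB => ?_
  rw [← inter_eq_left.2 hB, inter_iUnion]
  exact isClosed_iUnion hμ hι fun i =>
    closedDiscrete_iff_forall_subset.1 (hA i) _ inter_subset_right

/-- Disjointness of the pieces lets the choices of cover members be glued into one function. -/
theorem hasKernel_iUnion (hμ : μ.IsRegular) {ι : Type (u + 1)}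
    (hι : #ι < Cardinal.lift.{u + 1} μ) {𝒰 : Set (Set (ClubSpace lam μ κ M C))}
    {F : ι → Set (ClubSpace lam μ κ M C)} (hF : ∀ i, HasKernel 𝒰 (F i))
    (hdisj : ∀ i j x, x ∈ F i → x ∈ F j → i = j) : HasKernel 𝒰 (⋃ i, F i) := by
  choose A hAF hA φ hφ hcov using hF
  have key : ∀ x, ∃ V : Set (ClubSpace lam μ κ M C), ∀ i, x ∈ F i → V = φ i x := by
    intro x
    by_cases hx : ∃ i, x ∈ F i
    · obtain ⟨i, hi⟩ := hx
      exact ⟨φ i x, fun j hj => by rw [hdisj i j x hi hj]⟩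
    · exact ⟨∅, fun i hi => absurd ⟨i, hi⟩ hx⟩
  choose ψ hψ using key
  refine ⟨⋃ i, A i, iUnion_mono hAF, closedDiscrete_iUnion hμ hι hA, ψ, ?_, ?_⟩
  · intro a ha
    obtain ⟨i, hi⟩ := mem_iUnion.1 ha
    rw [hψ a i (hAF i hi)]
    exact hφ i a hi
  · intro x hx
    obtain ⟨i, hi⟩ := mem_iUnion.1 hx
    obtain ⟨a, ha, hxa⟩ := hcov i x hi
    exact ⟨a, mem_iUnion.2 ⟨i, ha⟩, by rwa [hψ a i (hAF i ha)]⟩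

theorem hasKernel_union_iUnion (hμ : μ.IsRegular) {ι : Type (u + 1)}
    (hι : #ι < Cardinal.lift.{u + 1} μ) {𝒰 : Set (Set (ClubSpace lam μ κ M C))}
    {F : ι → Set (ClubSpace lam μ κ M C)} {F₀ : Set (ClubSpace lam μ κ M C)}
    (hF₀ : HasKernel 𝒰 F₀) (hF : ∀ i, HasKernel 𝒰 (F i))
    (hdisj₀ : ∀ i x, x ∈ F i → x ∉ F₀) (hdisj : ∀ i j x, x ∈ F i → x ∈ F j → i = j) :
    HasKernel 𝒰 (F₀ ∪ ⋃ i, F i) := by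
  have hinf : ℵ₀ ≤ Cardinal.lift.{u + 1} μ := aleph0_le_lift.2 hμ.aleph0_le
  have hU := hasKernel_iUnion hμ (ι := Option ι) (𝒰 := 𝒰) (F := fun i => i.elim F₀ F)
    (by
      rw [mk_option]
      exact add_lt_of_lt hinf hι (one_lt_aleph0.trans_le hinf))
    (by rintro (_ | i); exacts [hF₀, hF i])
    (by
      rintro (_ | i) (_ | j) x hx hx'
      · rfl
      · exact absurd hx (hdisj₀ j x hx')
      · exact absurd hx' (hdisj₀ i x hx)
      · rw [hdisj i j x hx hx'])
  rwa [iUnion_option] at hU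

theorem hasKernel_union (hμ : μ.IsRegular) {𝒰 : Set (Set (ClubSpace lam μ κ M C))}
    {F G : Set (ClubSpace lam μ κ M C)} (hF : HasKernel 𝒰 F) (hG : HasKernel 𝒰 G)
    (hdisj : ∀ x ∈ G, x ∉ F) : HasKernel 𝒰 (F ∪ G) := by
  have hinf : ℵ₀ ≤ Cardinal.lift.{u + 1} μ := aleph0_le_lift.2 hμ.aleph0_le
  have hU := hasKernel_union_iUnion hμ (ι := PUnit) (F := fun _ => G)
    ((lt_aleph0_of_finite _).trans_le hinf) hF (fun _ => hG) (fun _ => hdisj) (fun _ _ _ _ _ => rfl)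
  rwa [iUnion_const] at hU

theorem isClosed_of_mk_lt (h : ClubSpaceData lam μ κ M C) {A : Set (ClubSpace lam μ κ M C)}
    (hA : #A < Cardinal.lift.{u + 1} μ) : IsClosed A := by
  have := t2Space h
  rw [← iUnion_of_singleton_coe A]
  exact isClosed_iUnion h.regular hA fun i => isClosed_singleton

theorem isClosed_of_forall_inter_Iic (h : ClubSpaceData lam μ κ M C)
    {A : Set (ClubSpace lam μ κ M C)} (hA : ∀ β < lam.ord, IsClosed {x | x ∈ A ∧ x.fst ≤ β}) :
    IsClosed A := by
  refine ⟨isOpen_iff_forall_mem_open.2 fun y hy => ?_⟩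
  refine ⟨{x | x.fst ≤ y.fst} ∩ {x | x ∈ A ∧ x.fst ≤ y.fst}ᶜ, fun z hz hzA => hz.2 ⟨hzA, hz.1⟩,
    (isOpen_Iic h _).inter (hA _ y.fst_lt).isOpen_compl, le_refl y.fst, fun hy' => hy hy'.1⟩

theorem closedDiscrete_of_fst_eq (h : ClubSpaceData lam μ κ M C) {β : Ordinal.{u}}
    {A : Set (ClubSpace lam μ κ M C)} (hA : ∀ x ∈ A, x.fst = β) : ClosedDiscrete A := by
  refine closedDiscrete_iff_forall_subset.2 fun B hB =>
    ⟨isOpen_iff_forall_mem_open.2 fun y hy => ?_⟩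
  rcases le_or_gt y.fst β with hle | hlt
  · obtain ⟨U, hU, hyU, hlt⟩ := exists_isOpen_isolating h y
    refine ⟨U, fun z hz hzB => ?_, hU, hyU⟩
    have hzy : z ≠ y := by
      rintro rfl
      exact hy hzB
    have := hlt z hz hzy
    rw [hA z (hB hzB)] at this
    exact this.not_ge hle
  · exact ⟨{z | β < z.fst}, fun z hz hzB => (hA z (hB hzB)).not_gt hz, isOpen_Ioi h β, hlt⟩

/-! ### Accumulation points in the space and failure of linear D -/

theorem index_pos (h : ClubSpaceData lam μ κ M C) : 0 < κ := by
  obtain ⟨φ, hφ, -⟩ := exists_mad_frequently h.regular h.mad (A := Iio μ.ord) <|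
    (mem_fullSubsets_iff h.regular subset_rfl).2 fun η hη => ⟨η, hη, le_rfl⟩
  exact zero_le.trans_lt hφ

theorem exists_fst_eq (h : ClubSpaceData lam μ κ M C) {α : Ordinal.{u}} (hα : α < lam.ord) :
    ∃ x : ClubSpace lam μ κ M C, x.fst = α ∧ x.snd = 0 :=
  ⟨⟨(α, 0), hα, index_pos h, fun _ => rfl⟩, rfl, rfl⟩

/-- Membership in a neighbourhood of `x` depends, away from `x`, only on the first coordinate, so
meeting the projection of `F` amounts to meeting `F`. -/
theorem mem_of_frequently (h : ClubSpaceData lam μ κ M C) {F : Set (ClubSpace lam μ κ M C)}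
    (hF : IsClosed F) {x : ClubSpace lam μ κ M C} (hx : x.fst.cof = μ)
    (hfreq : ∀ η < μ.ord, ∃ ξ ∈ M x.snd, η ≤ ξ ∧ ∃ γ ∈ fst '' F, γ ∈ clubInterval (C x.fst) ξ) :
    x ∈ F := by
  by_contra hxF
  obtain ⟨B, hB, hsub⟩ := (isOpen_iff h.regular).1 hF.isOpen_compl x hxF
  obtain ⟨η, hη, rfl⟩ := (mem_nhdBase_of_eq hx).1 hB
  obtain ⟨ξ, hξ, hle, _, ⟨y, hy, rfl⟩, hyξ⟩ := hfreq η hη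
  exact hsub (Or.inr ⟨ξ, hξ, hle, hyξ⟩) hy

theorem exists_point_frequently (h : ClubSpaceData lam μ κ M C) {α : Ordinal.{u}}
    (hα : α < lam.ord) (hcof : α.cof = μ) {Γ : Set Ordinal.{u}}
    (hunb : ∀ β < α, ∃ γ ∈ Γ, γ < α ∧ β < γ) :
    ∃ x : ClubSpace lam μ κ M C, x.fst = α ∧
      ∀ η < μ.ord, ∃ ξ ∈ M x.snd, η ≤ ξ ∧ ∃ γ ∈ Γ, γ ∈ clubInterval (C x.fst) ξ := by
  obtain ⟨φ, hφ, hf⟩ := (h.clubSeq.isClubIn h.regular hα hcof).exists_mad_frequently h.mad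
    (Γ := {γ | γ ∈ Γ ∧ γ < α}) (fun γ hγ => hγ.2) (fun β hβ => by
      obtain ⟨γ, hγ, h1, h2⟩ := hunb β hβ
      exact ⟨γ, ⟨hγ, h1⟩, h2⟩)
  refine ⟨point hα hφ hcof, rfl, fun η hη => ?_⟩
  obtain ⟨ξ, hξ, hle, γ, hγ, hmem⟩ := hf η hη
  exact ⟨ξ, hξ, hle, γ, hγ.1, hmem⟩

theorem exists_frequently_of_le_mk (h : ClubSpaceData lam μ κ M C) (hcof : μ < lam.ord.cof)
    {Γ : Set Ordinal.{u}} (hΓ : ∀ γ ∈ Γ, γ < lam.ord) (hcard : Cardinal.lift.{u + 1} μ ≤ #Γ) :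
    ∃ x : ClubSpace lam μ κ M C, x.fst.cof = μ ∧
      ∀ η < μ.ord, ∃ ξ ∈ M x.snd, η ≤ ξ ∧ ∃ γ ∈ Γ, γ ∈ clubInterval (C x.fst) ξ := by
  obtain ⟨α, hα, hαcof, hunb⟩ := exists_cofSet_limit h.regular hcof hΓ hcard
  obtain ⟨x, rfl, hx⟩ := exists_point_frequently h hα hαcof hunb
  exact ⟨x, hαcof, hx⟩

theorem mk_fst_image_lt (h : ClubSpaceData lam μ κ M C) (hcof : μ < lam.ord.cof)
    {D : Set (ClubSpace lam μ κ M C)} (hD : ClosedDiscrete D) :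
    #(fst '' D) < Cardinal.lift.{u + 1} μ := by
  by_contra! hle
  obtain ⟨x, hx, hfreq⟩ := exists_frequently_of_le_mk h hcof (Γ := fst '' D)
    (by rintro _ ⟨y, -, rfl⟩; exact y.fst_lt) hle
  -- All subsets of `D` are closed; deleting `x` loses none of the accumulation at `x`, whose
  -- intervals lie below `x.fst`.
  have hcl : IsClosed (D \ {x}) := closedDiscrete_iff_forall_subset.1 hD _ sdiff_subset
  refine (mem_of_frequently h hcl hx fun η hη => ?_).2 rfl
  obtain ⟨ξ, hξ, hηξ, _, ⟨y, hy, rfl⟩, hyξ⟩ := hfreq η hη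
  refine ⟨ξ, hξ, hηξ, _, ⟨y, ⟨hy, ?_⟩, rfl⟩, hyξ⟩
  rintro rfl
  exact ((isClubIn h hx).lt_of_mem_clubInterval (lt_of_mem_M h hξ) hyξ).false

/-- If `cf(lam) = μ`, one point over each element of a cofinal set of type `μ` gives a closed
unbounded set: its bounded parts have fewer than `μ` points. Its fibres have at most one point, so
it cannot be high enough. -/
theorem lt_cof_of_high (h : ClubSpaceData lam μ κ M C) (hlam : μ < lam)
    (hcof : μ ≤ lam.ord.cof) (hhigh : IsHighClubSpace lam μ κ M C) : μ < lam.ord.cof := by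
  refine hcof.lt_of_ne fun heq => ?_
  have := t2Space h
  have hlim : Order.IsSuccLimit lam.ord :=
    Cardinal.isSuccLimit_ord (h.regular.aleph0_le.trans hlam.le)
  obtain ⟨s, hs, -, hsu, hsc⟩ := exists_unbounded_of_cof lam.ord
  rw [← heq] at hsc
  let D : Set (ClubSpace lam μ κ M C) := {x | x.fst ∈ s ∧ x.snd = 0}
  have hinj : ∀ x ∈ D, ∀ y ∈ D, x.fst = y.fst → x = y :=
    fun x hx y hy hxy => ext hxy (hx.2.trans hy.2.symm)
  have hunb : Unbounded D := by
    intro β hβ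
    obtain ⟨i, hi, hle⟩ := hsu _ (hlim.add_one_lt hβ)
    obtain ⟨x, rfl, hx⟩ := exists_fst_eq h (hs hi)
    exact ⟨x, ⟨hi, hx⟩, (lt_add_one β).trans_le hle⟩
  have hclosed : IsClosed D := by
    refine isClosed_of_forall_inter_Iic h fun β hβ => isClosed_of_mk_lt h ?_
    obtain ⟨c, hc, hle⟩ := hsu _ (hlim.add_one_lt hβ)
    refine lt_of_le_of_lt ?_ (hsc c hc)
    refine mk_le_of_injective (f := fun x : {x | x ∈ D ∧ x.fst ≤ β} =>
      ⟨x.1.fst, x.2.1.1, x.2.2.trans_lt ((lt_add_one β).trans_le hle)⟩) fun x y hxy => ?_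
    exact Subtype.ext (hinj _ x.2.1 _ y.2.1 (congrArg Subtype.val hxy))
  have hhD := hhigh D hclosed hunb
  obtain ⟨⟨α, hα, hαD⟩⟩ := mk_ne_zero_iff.1
    (((Cardinal.lift_lt.2 h.regular.pos).trans_le hhD).trans_le' (by simp)).ne'
  have hsub : D.Subsingleton := by
    rw [← mk_le_one_iff_set_subsingleton, ← hαD, mk_le_one_iff_set_subsingleton]
    exact fun x hx y hy => hinj x hx.1 y hy.1 (hx.2.trans hy.2.symm)
  obtain ⟨x, hx, -⟩ := hunb 0 (hlim.bot_lt)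
  obtain ⟨y, hy, hxy⟩ := hunb x.fst x.fst_lt
  exact hxy.ne (congrArg fst (hsub hx hy))

theorem not_isLinearlyD (h : ClubSpaceData lam μ κ M C) (hcof : μ < lam.ord.cof) :
    ¬ IsLinearlyD (ClubSpace lam μ κ M C) := by
  intro hL
  obtain ⟨D, hD, hcov⟩ := hL (fun x => {y | y.fst ≤ x.fst})
    (fun x => ⟨isOpen_Iic h x.fst, le_refl x.fst⟩)
    (fun x y => (le_total x.fst y.fst).imp (fun hle z hz => le_trans hz hle)
      (fun hle z hz => le_trans hz hle))
  obtain ⟨b, hb, hlt⟩ := exists_lt_of_mk_lt_cof (a := lam.ord)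
    ((mk_fst_image_lt h hcof hD).trans (Cardinal.lift_lt.2 hcof))
    (by rintro _ ⟨y, -, rfl⟩; exact y.fst_lt)
  obtain ⟨x, rfl, -⟩ := exists_fst_eq h hb
  obtain ⟨d, hd, hxd⟩ := mem_iUnion₂.1 (hcov.ge (mem_univ x))
  exact (hlt _ (mem_image_of_mem _ hd)).not_ge hxd

/-! ### Property aD for bounded closed sets -/

theorem hasKernel_of_bounded (h : ClubSpaceData lam μ κ M C)
    {𝒰 : Set (Set (ClubSpace lam μ κ M C))} (hopen : ∀ U ∈ 𝒰, IsOpen U) (hcov : ⋃₀ 𝒰 = Set.univ)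
    {β : Ordinal.{u}} (hβ : β < lam.ord) {F : Set (ClubSpace lam μ κ M C)} (hF : IsClosed F)
    (hFβ : ∀ x ∈ F, x.fst ≤ β) : HasKernel 𝒰 F := by
  have := t2Space h
  induction β using WellFoundedLT.induction generalizing F with
  | ind β ih =>
    rcases lt_trichotomy β.cof μ with hcof | hcof | hcof
    -- Small cofinality: split `F` into its at most one point over `β` and fewer than `μ` bounded
    -- pieces, sorted by the least element of `s` that is at least the first coordinate.
    · obtain ⟨s, hs, hsc, hsu, -⟩ := exists_unbounded_of_cof β
      have hU := hasKernel_union_iUnion h.regular (ι := s) (𝒰 := 𝒰)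
        (F := fun i => {x | x ∈ F ∧ x.fst ≤ i ∧ ∀ j ∈ s, j < (i : Ordinal.{u}) → j < x.fst})
        (F₀ := {x | x ∈ F ∧ x.fst = β}) (by rwa [hsc, Cardinal.lift_lt])
        (HasKernel.of_subsingleton hcov fun x hx y hy =>
          eq_of_fst_eq (hy.2 ▸ hcof.ne) (hx.2.trans hy.2.symm))
        (fun i => by
          have hcl : IsClosed {x : ClubSpace lam μ κ M C |
              ∀ j ∈ s, j < (i : Ordinal.{u}) → j < x.fst} := by
            simp only [ofPred_forall]
            exact isClosed_biInter fun j _ => isClosed_iInter fun _ => (isClopen_Ioi h j).1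
          exact ih i (hs i.2) ((hs i.2).trans hβ)
            (hF.inter ((isClopen_Iic h (i : Ordinal.{u})).1.inter hcl)) fun x hx => hx.2.1)
        (fun i x hx hx' => (hx.2.1.trans_lt (hs i.2)).ne hx'.2)
        (fun i j x hx hx' => by
          rcases lt_trichotomy (i : Ordinal.{u}) j with hl | he | hl
          · exact absurd hx.2.1 (hx'.2.2 i i.2 hl).not_ge
          · exact Subtype.ext he
          · exact absurd hx'.2.1 (hx.2.2 j j.2 hl).not_ge)
      convert hU using 1
      ext x
      refine ⟨fun hx => ?_, ?_⟩
      · rcases (hFβ x hx).eq_or_lt with he | hlt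
        · exact Or.inl ⟨hx, he⟩
        · obtain ⟨i, hi, hle⟩ := hsu _ hlt
          have hne : {i | i ∈ s ∧ x.fst ≤ i}.Nonempty := ⟨i, hi, hle⟩
          obtain ⟨h1, h2⟩ := csInf_mem hne
          refine Or.inr (mem_iUnion.2 ⟨⟨_, h1⟩, hx, h2, fun j hj hlt => ?_⟩)
          by_contra! hc
          exact notMem_of_lt_csInf' hlt ⟨hj, hc⟩
      · rintro (hx | hx)
        · exact hx.1
        · obtain ⟨i, hi⟩ := mem_iUnion.1 hx
          exact hi.1
    · choose φ hφ using fun x : ClubSpace lam μ κ M C => mem_sUnion.1 (hcov.ge (mem_univ x))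
      let A : Set (ClubSpace lam μ κ M C) := {x | x ∈ F ∧ x.fst = β}
      let W : Set (ClubSpace lam μ κ M C) := ⋃ x ∈ A, φ x
      have hW : IsOpen W := isOpen_biUnion fun x _ => hopen _ (hφ x).1
      have hAW : A ⊆ W := fun x hx => mem_biUnion hx (hφ x).2
      have hcl : IsClosed (F \ W) := hF.sdiff hW
      -- Were the part of `F` outside `W` unbounded in `β`, it would accumulate at a point over `β`,
      -- and that point belongs to `A ⊆ W`.
      obtain ⟨b, hb, hFb⟩ : ∃ b < β, ∀ x ∈ F \ W, x.fst ≤ b := by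
        by_contra! hc
        obtain ⟨x, rfl, hfreq⟩ := exists_point_frequently h hβ hcof (Γ := fst '' (F \ W))
          (fun b hb => by
            obtain ⟨x, hx, hbx⟩ := hc b hb
            refine ⟨_, mem_image_of_mem _ hx, (hFβ x hx.1).lt_of_ne fun he => ?_, hbx⟩
            exact hx.2 (hAW ⟨hx.1, he⟩))
        have hx := mem_of_frequently h hcl hcof hfreq
        exact hx.2 (hAW ⟨hx.1, rfl⟩)
      have hU := hasKernel_union h.regular (𝒰 := 𝒰) (F := F \ W) (G := F ∩ W)
        (ih b hb (hb.trans hβ) hcl hFb)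
        ⟨A, fun x hx => ⟨hx.1, hAW hx⟩, closedDiscrete_of_fst_eq h fun x hx => hx.2, φ,
          fun a _ => hφ a, fun x hx => by simpa [W] using hx.2⟩
        (fun x hx hx' => hx'.2 hx.2)
      rwa [union_comm, inter_union_sdiff] at hU
    · obtain ⟨x, rfl, -⟩ := exists_fst_eq h hβ
      have hIic : ∀ b < x.fst, HasKernel 𝒰 (F ∩ {y | y.fst ≤ b}) := fun b hb =>
        ih b hb (hb.trans hβ) (hF.inter (isClopen_Iic h b).1) fun y hy => hy.2
      by_cases hx : x ∈ F
      · obtain ⟨U, hU, hxU⟩ := mem_sUnion.1 (hcov.ge (mem_univ x))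
        obtain ⟨B, hB, hsub⟩ := (isOpen_iff h.regular).1 (hopen U hU) x hxU
        obtain ⟨b, hb, rfl⟩ := (mem_nhdBase_of_gt hcof).1 hB
        -- One member of the cover around `x` takes care of everything above `b`.
        have hK := hasKernel_union h.regular (G := F \ {y | y.fst ≤ b}) (hIic b hb)
          ⟨{x}, by simpa using ⟨hx, hb⟩, closedDiscrete_of_fst_eq h (β := x.fst) (by simp),
            fun _ => U, by simpa using ⟨hU, hxU⟩,
            fun y hy => ⟨x, rfl, hsub ⟨not_le.1 hy.2, hFβ y hy.1⟩⟩⟩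
          (fun y hy hy' => hy.2 hy'.2)
        rwa [inter_union_sdiff] at hK
      · obtain ⟨B, hB, hsub⟩ := (isOpen_iff h.regular).1 hF.isOpen_compl x hx
        obtain ⟨b, hb, rfl⟩ := (mem_nhdBase_of_gt hcof).1 hB
        have hK := hIic b hb
        rwa [inter_eq_left.2] at hK
        intro y hy
        by_contra hc
        exact hsub ⟨not_le.1 hc, hFβ y hy⟩ hy

/-! ### Property aD for unbounded closed sets -/

/-- The union of the members of `𝒰` that include the fibre over `γ`. -/
def fiberStar (𝒰 : Set (Set (ClubSpace lam μ κ M C))) (γ : Ordinal.{u}) :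
    Set (ClubSpace lam μ κ M C) :=
  ⋃₀ {U | U ∈ 𝒰 ∧ ∀ y : ClubSpace lam μ κ M C, y.fst = γ → y ∈ U}

/-- The part of `F` left uncovered by the stars of the fibres over `Z`. -/
def remainder (𝒰 : Set (Set (ClubSpace lam μ κ M C))) (F : Set (ClubSpace lam μ κ M C))
    (Z : Set Ordinal.{u}) : Set (ClubSpace lam μ κ M C) :=
  F \ ⋃ γ ∈ Z, fiberStar 𝒰 γ

theorem isClosed_remainder {𝒰 : Set (Set (ClubSpace lam μ κ M C))} (hopen : ∀ U ∈ 𝒰, IsOpen U)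
    {F : Set (ClubSpace lam μ κ M C)} (hF : IsClosed F) (Z : Set Ordinal.{u}) :
    IsClosed (remainder 𝒰 F Z) :=
  hF.sdiff (isOpen_biUnion fun _ _ => isOpen_sUnion fun U hU => hopen U hU.1)

/-- A bijection from the fibre part of `E` onto `E` lets each fibre point carry a cover member
chosen for its image. That member includes the whole fibre, hence also the point carrying it. -/
theorem hasKernel_inter_fiberStar (h : ClubSpaceData lam μ κ M C)
    {𝒰 : Set (Set (ClubSpace lam μ κ M C))} (hcov : ⋃₀ 𝒰 = Set.univ)
    {E : Set (ClubSpace lam μ κ M C)} {γ : Ordinal.{u}}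
    (hγ : #{x : ClubSpace lam μ κ M C | x ∈ E ∧ x.fst = γ} = #E) :
    HasKernel 𝒰 (E ∩ fiberStar 𝒰 γ) := by
  have := t2Space h
  rcases (E ∩ fiberStar 𝒰 γ).eq_empty_or_nonempty with he | ⟨_, -, U₀, ⟨hU₀, hU₀γ⟩, -⟩
  · rw [he]
    exact HasKernel.of_subsingleton hcov subsingleton_empty
  obtain ⟨e⟩ := Cardinal.eq.1 hγ
  have hu : ∀ y : ClubSpace lam μ κ M C, ∃ U ∈ 𝒰,
      (∀ z : ClubSpace lam μ κ M C, z.fst = γ → z ∈ U) ∧ (y ∈ fiberStar 𝒰 γ → y ∈ U) := by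
    intro y
    by_cases hy : y ∈ fiberStar 𝒰 γ
    · obtain ⟨U, ⟨hU, hUγ⟩, hyU⟩ := hy
      exact ⟨U, hU, hUγ, fun _ => hyU⟩
    · exact ⟨U₀, hU₀, hU₀γ, fun hy' => absurd hy' hy⟩
  choose u hu𝒰 huγ hu using hu
  have hφ : ∃ φ : ClubSpace lam μ κ M C → Set (ClubSpace lam μ κ M C),
      ∀ a : {x : ClubSpace lam μ κ M C | x ∈ E ∧ x.fst = γ}, φ a = u (e a) :=
    ⟨Function.extend Subtype.val (fun a => u (e a)) fun _ => ∅,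
      fun a => Subtype.val_injective.extend_apply _ _ a⟩
  obtain ⟨φ, hφ⟩ := hφ
  refine ⟨{x | x ∈ E ∧ x.fst = γ}, fun x hx => ⟨hx.1, U₀, ⟨hU₀, hU₀γ⟩, hU₀γ x hx.2⟩,
    closedDiscrete_of_fst_eq h fun x hx => hx.2, φ, fun a ha => ?_, fun x hx => ?_⟩
  · rw [hφ ⟨a, ha⟩]
    exact ⟨hu𝒰 _, huγ _ _ ha.2⟩
  · refine ⟨e.symm ⟨x, hx.1⟩, (e.symm ⟨x, hx.1⟩).2, ?_⟩
    rw [hφ, e.apply_symm_apply]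
    exact hu x hx.2

theorem hasKernel_of_isClosed (h : ClubSpaceData lam μ κ M C) (hcof : μ < lam.ord.cof)
    (hhigh : IsHighClubSpace lam μ κ M C) {𝒰 : Set (Set (ClubSpace lam μ κ M C))}
    (hopen : ∀ U ∈ 𝒰, IsOpen U) (hcov : ⋃₀ 𝒰 = Set.univ) {F : Set (ClubSpace lam μ κ M C)}
    (hF : IsClosed F) : HasKernel 𝒰 F := by
  -- Highness gives at least `μ` suitable fibres, so one lies outside `Z`.
  have step : ∀ Z : Set Ordinal.{u}, ∃ γ : Ordinal.{u}, #Z < Cardinal.lift.{u + 1} μ →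
      Unbounded (remainder 𝒰 F Z) → γ ∉ Z ∧ γ < lam.ord ∧
        #{x : ClubSpace lam μ κ M C | x ∈ remainder 𝒰 F Z ∧ x.fst = γ} = #(remainder 𝒰 F Z) := by
    intro Z
    by_contra! hc
    obtain ⟨hZ, hunb, -⟩ := hc 0
    refine ((hhigh _ (isClosed_remainder hopen hF Z) hunb).trans
      (mk_le_mk_of_subset fun γ hγ => ?_)).not_gt hZ
    by_contra hγZ
    exact (hc γ).2.2 hγZ hγ.1 hγ.2
  choose g hg using step
  -- Greedy recursion: the next fibre depends on the set of those already chosen.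
  let G : Ordinal.{u} → Ordinal.{u} := (wellFounded_lt (α := Ordinal.{u})).fix
    fun i G => g {γ | ∃ j, ∃ hj : j < i, G j hj = γ}
  have hG : ∀ i, G i = g (G '' Iio i) := by
    intro i
    refine ((wellFounded_lt (α := Ordinal.{u})).fix_eq _ i).trans (congrArg g ?_)
    ext γ
    simp [G]
  let E : Ordinal.{u} → Set (ClubSpace lam μ κ M C) := fun i => remainder 𝒰 F (G '' Iio i)
  have hspec : ∀ i < μ.ord, Unbounded (E i) → G i ∉ G '' Iio i ∧ G i < lam.ord ∧
      #{x : ClubSpace lam μ κ M C | x ∈ E i ∧ x.fst = G i} = #(E i) := by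
    intro i hi hu
    rw [hG i]
    exact hg _ (mk_image_le.trans_lt (mk_Iio_lt_lift hi)) hu
  have hEstar : ∀ i j x, j < i → x ∈ E i → x ∉ fiberStar 𝒰 (G j) := fun i j x hj hx hx' =>
    hx.2 (mem_biUnion (mem_image_of_mem G hj) hx')
  have hbdd : ∃ i < μ.ord, ¬ Unbounded (E i) := by
    by_contra! hunb
    have hinj : InjOn G (Iio μ.ord) := by
      intro i hi j hj hij
      rcases lt_trichotomy i j with hl | he | hl
      · exact absurd ⟨i, hl, hij⟩ (hspec j hj (hunb j hj)).1
      · exact he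
      · exact absurd ⟨j, hl, hij.symm⟩ (hspec i hi (hunb i hi)).1
    obtain ⟨x, hx, hfreq⟩ := exists_frequently_of_le_mk h hcof (Γ := G '' Iio μ.ord)
      (by rintro _ ⟨i, hi, rfl⟩; exact (hspec i hi (hunb i hi)).2.1)
      (by rw [mk_image_eq_of_injOn _ _ hinj, Cardinal.mk_Iio_ordinal, card_ord])
    obtain ⟨U, hU, hxU⟩ := mem_sUnion.1 (hcov.ge (mem_univ x))
    obtain ⟨B, hB, hsub⟩ := (isOpen_iff h.regular).1 (hopen U hU) x hxU
    obtain ⟨η, hη, rfl⟩ := (mem_nhdBase_of_eq hx).1 hB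
    have hcl := isClubIn h hx
    obtain ⟨ξ, hξ, hηξ, _, ⟨i, hi, rfl⟩, hiξ⟩ := hfreq η hη
    -- Asking for an index of at least `ξ + 1` forces a different interval, hence a second fibre
    -- inside `U`.
    obtain ⟨ζ, hζ, hξζ, _, ⟨j, hj, rfl⟩, hjζ⟩ := hfreq _ (hcl.add_one_lt (lt_of_mem_M h hξ))
    have hξζ' : ξ < ζ := (lt_add_one ξ).trans_le hξζ
    have hne : i ≠ j := by
      rintro rfl
      exact hξζ'.ne (hcl.eq_of_mem_clubInterval (lt_of_mem_M h hζ) (lt_of_mem_M h hξ) hiξ hjζ)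
    have hiU : ∀ y : ClubSpace lam μ κ M C, y.fst = G i → y ∈ U := fun y hy =>
      hsub (Or.inr ⟨ξ, hξ, hηξ, hy ▸ hiξ⟩)
    have hjU : ∀ y : ClubSpace lam μ κ M C, y.fst = G j → y ∈ U := fun y hy =>
      hsub (Or.inr ⟨ζ, hζ, hηξ.trans hξζ'.le, hy ▸ hjζ⟩)
    have key : ∀ i j, j < μ.ord → i < j →
        (∀ y : ClubSpace lam μ κ M C, y.fst = G i → y ∈ U) →
        (∀ y : ClubSpace lam μ κ M C, y.fst = G j → y ∈ U) → False := by
      intro i j hj hij hiU hjU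
      obtain ⟨y, hy, -⟩ := hunb j hj 0 (Cardinal.ord_pos.2 (zero_le.trans_lt
        (hcof.trans_le (cof_ord_le lam))))
      have hne : #(E j) ≠ 0 := mk_ne_zero_iff.2 ⟨⟨y, hy⟩⟩
      rw [← (hspec j hj (hunb j hj)).2.2] at hne
      obtain ⟨⟨z, hz, hzj⟩⟩ := mk_ne_zero_iff.1 hne
      -- `U` includes the fibre over `G i`, so the earlier star already swallowed the fibre over `G
      -- j`.
      exact hEstar j i z hij hz ⟨U, ⟨hU, hiU⟩, hjU z hzj⟩
    rcases hne.lt_or_gt with hl | hl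
    · exact key i j hj hl hiU hjU
    · exact key j i hi hl hjU hiU
  obtain ⟨i, ⟨hi, hiE⟩, hmin⟩ := (wellFounded_lt (α := Ordinal.{u})).has_min
    {i | i < μ.ord ∧ ¬ Unbounded (E i)} hbdd
  have hunb : ∀ j < i, Unbounded (E j) := fun j hj => by
    by_contra hc
    exact hmin j ⟨lt_trans hj hi, hc⟩ hj
  simp only [Unbounded, not_forall, not_exists, not_and, not_lt] at hiE
  obtain ⟨β, hβ, hβE⟩ := hiE
  have hK := hasKernel_union_iUnion h.regular (ι := Iio i) (𝒰 := 𝒰) (F₀ := E i)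
    (F := fun j => E j ∩ fiberStar 𝒰 (G j)) (mk_Iio_lt_lift hi)
    (hasKernel_of_bounded h hopen hcov hβ (isClosed_remainder hopen hF _) hβE)
    (fun j => hasKernel_inter_fiberStar h hcov (hspec j (lt_trans j.2 hi) (hunb j j.2)).2.2)
    (fun j x hx hx' => hEstar i j x j.2 hx' hx.2)
    (fun j k x hx hx' => by
      rcases lt_trichotomy (j : Ordinal.{u}) k with hl | he | hl
      · exact absurd hx.2 (hEstar _ _ x hl hx'.1)
      · exact Subtype.ext he
      · exact absurd hx'.2 (hEstar _ _ x hl hx.1))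
  convert hK using 1
  ext x
  refine ⟨fun hx => ?_, ?_⟩
  · by_cases hxi : x ∈ E i
    · exact Or.inl hxi
    · have hne : {j | j < i ∧ x ∈ fiberStar 𝒰 (G j)}.Nonempty := by
        by_contra hc
        refine hxi ⟨hx, fun hx' => ?_⟩
        obtain ⟨_, ⟨j, hj, rfl⟩, hxj⟩ := mem_iUnion₂.1 hx'
        exact hc ⟨j, hj, hxj⟩
      -- The first star containing `x` determines the piece in which `x` lies.
      obtain ⟨h1, h2⟩ := csInf_mem hne
      refine Or.inr (mem_iUnion.2 ⟨⟨_, h1⟩, ⟨hx, fun hx' => ?_⟩, h2⟩)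
      obtain ⟨_, ⟨j, hj, rfl⟩, hxj⟩ := mem_iUnion₂.1 hx'
      exact notMem_of_lt_csInf' (s := {j | j < i ∧ x ∈ fiberStar 𝒰 (G j)}) hj
        ⟨lt_trans hj h1, hxj⟩
  · rintro (hx | hx)
    · exact hx.1
    · obtain ⟨j, hj⟩ := mem_iUnion.1 hx
      exact hj.1.1

theorem isADSpace (h : ClubSpaceData lam μ κ M C) (hcof : μ < lam.ord.cof)
    (hhigh : IsHighClubSpace lam μ κ M C) : IsADSpace (ClubSpace lam μ κ M C) := by
  intro F hF 𝒰 hopen hcov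
  obtain ⟨A, hAF, hA, φ, hφ, hFφ⟩ := hasKernel_of_isClosed h hcof hhigh hopen hcov hF
  refine ⟨A, hAF, hA, fun a => φ a, fun a => hφ a a.2, fun x hx => ?_⟩
  obtain ⟨a, ha, hxa⟩ := hFφ x hx
  exact mem_iUnion.2 ⟨⟨a, ha⟩, hxa⟩

end ClubSpace

theorem mainTheorem2 (lam μ : Cardinal.{u}) (hμ : μ.IsRegular) (hlam : μ < lam)
    (hcof : μ ≤ lam.ord.cof) (κ : Ordinal.{u}) (M : Ordinal.{u} → Set Ordinal.{u})
    (hM : IsMADFamily μ (M '' Set.Iio κ)) (hMinj : Set.InjOn M (Set.Iio κ))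
    (C : Ordinal.{u} → Set Ordinal.{u}) (hC : IsClubSeq lam μ C)
    (hhigh : IsHighClubSpace lam μ κ M C) :
    ZeroDim (ClubSpace lam μ κ M C) ∧ T2Space (ClubSpace lam μ κ M C) ∧
      ScatteredSpace (ClubSpace lam μ κ M C) ∧ IsADSpace (ClubSpace lam μ κ M C) ∧
      ¬ IsLinearlyD (ClubSpace lam μ κ M C) := by
  have h : ClubSpaceData lam μ κ M C := ⟨hμ, hM, hMinj, hC⟩
  have hcof' := ClubSpace.lt_cof_of_high h hlam hcof hhigh
  exact ⟨ClubSpace.zeroDim h, ClubSpace.t2Space h, ClubSpace.scatteredSpace h,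
    ClubSpace.isADSpace h hcof' hhigh, ClubSpace.not_isLinearlyD h hcof'⟩
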